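/- Let $p:E\to M$ be a finite-dimensional smooth fibered manifold, i.e. a smooth surjective submersion of finite-dimensional smooth manifolds ($M$ Hausdorff). Its first jet bundle $JE$ consists of the pairs $(e,j)$ with $e\in E$ and $j:T_{p(e)}M\to T_eE$ linear such that $T_ep\circ j=\mathrm{id}$; it is a smooth fibered manifold over $M$ (so $JJE:=J(JE\to M)$ is defined), with projection $p_E:JE\to E$. A morphism $f:E\to E'$ over $M$ has the jet prolongation $Jf:JE\to JE'$, $j\mapsto T_ef\circ j$. A fibered chart $(x^a,y^i)$ of $E$ induces charts $(x^a,y^i,y^i_a)$ of $JE$ and $(x^a,y^i,\underline y^i_a;y^i_a,y^i_{ab})$ of $JJE$, where $y^i_a(j)=dy^i(j(\partial_a))$, $\underline y^i_a=y^i_a\circ p_{JE}$, $y^i_a=y^i_a\circ Jp_E$ and $y^i_{ab}=(y^i_a)_b$. A connection of $E\to M$ is a smooth section $\kappa:E\to JE$ of $p_E$, with components $\kappa^i_a=y^i_a\circ\kappa$; a connection of $JE\to M$ is likewise a smooth section $JE\to JJE$ of $p_{JE}:JJE\to JE$. Let $\Gamma$ be a smooth symmetric (torsion-free) linear connection of $TM\to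 M$, with components $\Gamma_a{}^c{}_b$ in the convention $\nabla_a v^c=\partial_a v^c-\Gamma_a{}^c{}_b v^b$, and let $\kappa$ be a connection of $E\to M$. (1) There is a smooth involution $s_\Gamma:JJE\to JJE$ over $E$ (Modugno's involution) with the expression $$(x^a,y^i,\underline y^i_a;y^i_a,y^i_{ab})\circ s_\Gamma=\bigl(x^a,y^i,y^i_a;\underline y^i_a,\;y^i_{ba}+\Gamma_b{}^c{}_a(\underline y^i_c-y^i_c)\bigr)$$ in every fibered chart. (2) The composition $\kappa':=s_\Gamma\circ J\kappa:JE\to JJE$ is a connection of $JE\to M$. It is projectable over $\kappa$, i.e. $Jp_E\circ\kappa'=\kappa\circ p_E$. In every fibered chart its expression is $$(x^a,y^i,\underline y^i_a;y^i_a,y^i_{ab})\circ\kappa'=\Bigl(x^a,y^i,y^i_a;\;\kappa^i_a,\;\frac{\partial\kappa^i_b}{\partial x^a}+y^j_a\frac{\partial\kappa^i_b}{\partial y^j}+\Gamma_b{}^c{}_a(\kappa^i_c-y^i_c)\Bigr).$$ -/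

import Mathlib

open scoped Manifold ContDiff Topology

noncomputable section

set_option linter.unusedSectionVars false

namespace JetBundle

section Basic

variable (B F : Type*) [NormedAddCommGroup B] [NormedSpace ℝ B]
  [NormedAddCommGroup F] [NormedSpace ℝ F]
  {M E : Type*} [TopologicalSpace M] [ChartedSpace B M]
  [TopologicalSpace E] [ChartedSpace (B × F) E]

/-- A fibered manifold `p : E → M`: a smooth surjective submersion. Here `M` is modelled on `B`, `E`
is modelled on `B × F`, and the kernel of the differential of `p` is modelled on `F`. -/
class IsFiberedManifold (p : E → M) : Prop where
  surjective : Function.Surjective p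
  submersion : Manifold.IsSubmersionOfComplement F 𝓘(ℝ, B × F) 𝓘(ℝ, B) ∞ p

/-- A (local) fibered chart of `p : E → M`: charts of the smooth manifolds `E` and `M` in which
`p` is the projection `(x, y) ↦ x`. -/
structure FiberedChart (p : E → M) where
  tot : OpenPartialHomeomorph E (B × F)
  base : OpenPartialHomeomorph M B
  tot_mem : tot ∈ IsManifold.maximalAtlas 𝓘(ℝ, B × F) ∞ E
  base_mem : base ∈ IsManifold.maximalAtlas 𝓘(ℝ, B) ∞ M
  mapsTo : ∀ e ∈ tot.source, p e ∈ base.source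
  fst_eq : ∀ e ∈ tot.source, (tot e).1 = base (p e)

/-- The first jet prolongation `J E` of `p : E → M`: pairs of a point `e` of `E` and a linear map
`T_{p e} M → T_e E` which is a section of the tangent map of `p`. -/
@[ext]
structure Jet (p : E → M) where
  pt : E
  lin : TangentSpace 𝓘(ℝ, B) (p pt) →L[ℝ] TangentSpace 𝓘(ℝ, B × F) pt
  comp_lin : (mfderiv 𝓘(ℝ, B × F) 𝓘(ℝ, B) p pt).comp lin = ContinuousLinearMap.id ℝ _

variable {B F}

theorem exists_fiberedChart [IsManifold 𝓘(ℝ, B × F) ∞ E] (p : E → M) [hp : IsFiberedManifold B F p]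
    (e : E) : ∃ c : FiberedChart B F p, e ∈ c.tot.source := by
  have h := hp.submersion e
  refine ⟨⟨h.domChart.transHomeomorph h.equiv.toHomeomorph, h.codChart, ?_,
    h.codChart_mem_maximalAtlas, fun e he => h.mapsto_domChart_source_codChart_source he, ?_⟩,
    h.mem_domChart_source⟩
  · rw [IsManifold.mem_maximalAtlas_iff_contMDiffOn]
    have h1 := contMDiffOn_of_mem_maximalAtlas h.domChart_mem_maximalAtlas
    have h2 := contMDiffOn_symm_of_mem_maximalAtlas h.domChart_mem_maximalAtlas
    refine ⟨?_, ?_⟩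
    · exact (h.equiv.contDiff.contMDiff).comp_contMDiffOn h1
    · refine h2.comp (h.equiv.symm.contDiff.contMDiff).contMDiffOn ?_
      intro x hx
      exact hx
  · intro e he
    have he' : e ∈ h.domChart.source := he
    have hx : h.domChart e ∈ (h.domChart.extend 𝓘(ℝ, B × F)).target := by
      simpa using h.domChart.map_source he'
    have := h.writtenInCharts hx
    simp [he'] at this
    simp [this]

theorem IsFiberedManifold.contMDiff (p : E → M) [hp : IsFiberedManifold B F p] :
    ContMDiff 𝓘(ℝ, B × F) 𝓘(ℝ, B) ∞ p := hp.submersion.contMDiff 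

theorem mdiff_chart {V N : Type*} [NormedAddCommGroup V] [NormedSpace ℝ V] [TopologicalSpace N]
    [ChartedSpace V N] [IsManifold 𝓘(ℝ, V) ∞ N] {φ : OpenPartialHomeomorph N V}
    (h : φ ∈ IsManifold.maximalAtlas 𝓘(ℝ, V) ∞ N) : φ.MDifferentiable 𝓘(ℝ, V) 𝓘(ℝ, V) :=
  ⟨(contMDiffOn_of_mem_maximalAtlas h).mdifferentiableOn (by simp),
    (contMDiffOn_symm_of_mem_maximalAtlas h).mdifferentiableOn (by simp)⟩


namespace FiberedChart

variable [IsManifold 𝓘(ℝ, B) ∞ M] [IsManifold 𝓘(ℝ, B × F) ∞ E] {p : E → M} (c : FiberedChart B F p)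

/-- The tangent map of the chart of the total space, `T_e E → B × F`. -/
def dtot (e : E) : TangentSpace 𝓘(ℝ, B × F) e →L[ℝ] B × F :=
  mfderiv 𝓘(ℝ, B × F) 𝓘(ℝ, B × F) c.tot e

/-- The tangent map of the chart of the base, `T_x M → B`. -/
def dbase (x : M) : TangentSpace 𝓘(ℝ, B) x →L[ℝ] B :=
  mfderiv 𝓘(ℝ, B) 𝓘(ℝ, B) c.base x

theorem dtot_inv {e : E} (he : e ∈ c.tot.source) :
    (c.dtot e).comp (c.dtot e).inverse = ContinuousLinearMap.id ℝ _ ∧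
    (c.dtot e).inverse.comp (c.dtot e) = ContinuousLinearMap.id ℝ _ := by
  obtain ⟨L, h⟩ : ∃ L : TangentSpace 𝓘(ℝ, B × F) e ≃L[ℝ] B × F, c.dtot e = L :=
    ⟨(mdiff_chart c.tot_mem).mfderiv he, by ext1 v; rfl⟩
  rw [h]
  exact ⟨ContinuousLinearMap.ext fun v => by simp, ContinuousLinearMap.ext fun v => by simp⟩

theorem dbase_inv {x : M} (hx : x ∈ c.base.source) :
    (c.dbase x).comp (c.dbase x).inverse = ContinuousLinearMap.id ℝ _ ∧
    (c.dbase x).inverse.comp (c.dbase x) = ContinuousLinearMap.id ℝ _ := by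
  obtain ⟨L, h⟩ : ∃ L : TangentSpace 𝓘(ℝ, B) x ≃L[ℝ] B, c.dbase x = L :=
    ⟨(mdiff_chart c.base_mem).mfderiv hx, by ext1 v; rfl⟩
  rw [h]
  exact ⟨ContinuousLinearMap.ext fun v => by simp, ContinuousLinearMap.ext fun v => by simp⟩

theorem fst_dtot [hp : IsFiberedManifold B F p] {e : E} (he : e ∈ c.tot.source) :
    (ContinuousLinearMap.fst ℝ B F).comp (c.dtot e) =
      (c.dbase (p e)).comp (mfderiv 𝓘(ℝ, B × F) 𝓘(ℝ, B) p e) := by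
  have h1 : MDifferentiableAt 𝓘(ℝ, B × F) 𝓘(ℝ, B × F) c.tot e :=
    (mdiff_chart c.tot_mem).mdifferentiableAt he
  have h2 : MDifferentiableAt 𝓘(ℝ, B) 𝓘(ℝ, B) c.base (p e) :=
    (mdiff_chart c.base_mem).mdifferentiableAt (c.mapsTo e he)
  have h3 : MDifferentiableAt 𝓘(ℝ, B × F) 𝓘(ℝ, B) p e :=
    (IsFiberedManifold.contMDiff p).mdifferentiable (by simp) e
  have h4 : MDifferentiableAt 𝓘(ℝ, B × F) 𝓘(ℝ, B) (ContinuousLinearMap.fst ℝ B F) (c.tot e) :=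
    (ContinuousLinearMap.fst ℝ B F).differentiableAt.mdifferentiableAt
  have h5 := mfderiv_comp e h4 h1
  have h6 := mfderiv_comp e h2 h3
  have h7 : (ContinuousLinearMap.fst ℝ B F) ∘ c.tot =ᶠ[𝓝 e] c.base ∘ p := by
    filter_upwards [c.tot.open_source.mem_nhds he] with e' he' using c.fst_eq e' he'
  have h8 := h7.mfderiv_eq (I := 𝓘(ℝ, B × F)) (I' := 𝓘(ℝ, B))
  rw [h5, h6] at h8
  simp only [mfderiv_eq_fderiv, ContinuousLinearMap.fderiv] at h8
  exact h8

/-- The fiber coordinates `y^i_a` of a jet `j`, as the linear map `B → F` with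
matrix `(y^i_a)`: it sends `v` to the vertical component of `j(∂_v)`. -/
def slope (j : Jet B F p) : B →L[ℝ] F :=
  (ContinuousLinearMap.snd ℝ B F).comp
    ((c.dtot j.pt).comp (j.lin.comp (c.dbase (p j.pt)).inverse))

/-- The jet at `e` with fiber coordinates `A`. -/
def mkJet [IsFiberedManifold B F p] (e : E) (he : e ∈ c.tot.source) (A : B →L[ℝ] F) : Jet B F p where
  pt := e
  lin := (c.dtot e).inverse.comp
    (((ContinuousLinearMap.id ℝ B).prod A).comp (c.dbase (p e)))
  comp_lin := by
    have h1 := c.dtot_inv he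
    have h2 := c.dbase_inv (c.mapsTo e he)
    have h3 := c.fst_dtot he
    ext1 v
    have h4 := congrArg (fun L => (c.dbase (p e)).inverse
      (L ((c.dtot e).inverse (c.dbase (p e) v, A (c.dbase (p e) v))))) h3
    have h5 : ∀ w, (c.dtot e) ((c.dtot e).inverse w) = w := fun w => DFunLike.congr_fun h1.1 w
    have h6 : ∀ w, (c.dbase (p e)).inverse (c.dbase (p e) w) = w := fun w => DFunLike.congr_fun h2.2 w
    simp only [ContinuousLinearMap.comp_apply, h5, h6] at h4
    simp [h6] at h4
    simpa using h4.symm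

theorem slope_mkJet [IsFiberedManifold B F p] (e : E) (he : e ∈ c.tot.source) (A : B →L[ℝ] F) :
    c.slope (c.mkJet e he A) = A := by
  have h1 := c.dtot_inv he
  have h2 := c.dbase_inv (c.mapsTo e he)
  have h5 : ∀ w, (c.dtot e) ((c.dtot e).inverse w) = w := fun w => DFunLike.congr_fun h1.1 w
  have h6 : ∀ w, (c.dbase (p e)) ((c.dbase (p e)).inverse w) = w := fun w => DFunLike.congr_fun h2.1 w
  ext1 v
  change (c.dtot e ((c.dtot e).inverse (c.dbase (p e) ((c.dbase (p e)).inverse v),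
    A (c.dbase (p e) ((c.dbase (p e)).inverse v))))).2 = A v
  rw [h5, h6]

theorem dtot_lin [IsFiberedManifold B F p] (j : Jet B F p) (he : j.pt ∈ c.tot.source) (w) :
    c.dtot j.pt (j.lin w) = (c.dbase (p j.pt) w, c.slope j (c.dbase (p j.pt) w)) := by
  have h2 := c.dbase_inv (c.mapsTo _ he)
  have h3 := c.fst_dtot he
  have h6 : ∀ w, (c.dbase (p j.pt)).inverse (c.dbase (p j.pt) w) = w :=
    fun w => DFunLike.congr_fun h2.2 w
  ext1
  · have := DFunLike.congr_fun h3 (j.lin w)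
    have h7 := DFunLike.congr_fun j.comp_lin w
    simp only [ContinuousLinearMap.comp_apply] at this h7
    rw [h7] at this
    exact this
  · simp [slope, h6]

theorem mkJet_slope [IsFiberedManifold B F p] (j : Jet B F p) (he : j.pt ∈ c.tot.source) :
    c.mkJet j.pt he (c.slope j) = j := by
  have h1 := c.dtot_inv he
  have h5 : ∀ w, (c.dtot j.pt).inverse (c.dtot j.pt w) = w := fun w => DFunLike.congr_fun h1.2 w
  obtain ⟨e, l, hl⟩ := j
  simp only [mkJet, Jet.mk.injEq, true_and]
  ext1 w
  have := c.dtot_lin ⟨e, l, hl⟩ he w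
  simp only at this h5
  simp [← this, h5]

theorem nonempty_jet [IsFiberedManifold B F p] (c : FiberedChart B F p) : Nonempty (Jet B F p) := by
  obtain ⟨d, hd⟩ := exists_fiberedChart (B := B) (F := F) p (c.tot.symm 0)
  exact ⟨d.mkJet _ hd 0⟩

open Classical in
/-- The chart `(x, y, y_a)` of `J E` induced by a fibered chart `(x, y)` of `E`, as a bare bijection. -/
def jetEquiv [IsFiberedManifold B F p] : PartialEquiv (Jet B F p) (B × (F × (B →L[ℝ] F))) where
  toFun j := ((c.tot j.pt).1, ((c.tot j.pt).2, c.slope j))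
  invFun z := if hz : (z.1, z.2.1) ∈ c.tot.target then
      c.mkJet (c.tot.symm (z.1, z.2.1)) (c.tot.map_target hz) z.2.2
    else c.nonempty_jet.some
  source := {j | j.pt ∈ c.tot.source}
  target := {z | (z.1, z.2.1) ∈ c.tot.target}
  map_source' := fun j hj => c.tot.map_source hj
  map_target' := fun z hz => by
    simp only [Set.mem_ofPred_eq] at hz
    simp only [hz, dite_true]
    exact c.tot.map_target hz
  left_inv' := fun j hj => by
    have h : ((c.tot j.pt).1, (c.tot j.pt).2) ∈ c.tot.target := c.tot.map_source hj
    simp only [h, dite_true]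
    have h2 : ∀ (e : E) (he : e ∈ c.tot.source), e = j.pt → c.mkJet e he (c.slope j) = j := by
      rintro e he rfl
      exact c.mkJet_slope j he
    exact h2 _ _ (c.tot.left_inv hj)
  right_inv' := fun z hz => by
    simp only [Set.mem_ofPred_eq] at hz
    simp only [hz, dite_true, slope_mkJet]
    simp [mkJet, c.tot.right_inv hz]

theorem jetEquiv_symm_pt [IsFiberedManifold B F p] {z : B × (F × (B →L[ℝ] F))}
    (hz : (z.1, z.2.1) ∈ c.tot.target) : (c.jetEquiv.symm z).pt = c.tot.symm (z.1, z.2.1) := by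
  simp [jetEquiv, PartialEquiv.symm, hz, mkJet]

variable (c' : FiberedChart B F p)

theorem dtot_change {e : E} (he : e ∈ c.tot.source) (he' : e ∈ c'.tot.source) :
    c'.dtot e = (fderiv ℝ (c'.tot ∘ c.tot.symm) (c.tot e)).comp (c.dtot e) := by
  have h1 := (mdiff_chart c.tot_mem).mdifferentiableAt he
  have h2 := (mdiff_chart c.tot_mem).mdifferentiableAt_symm (c.tot.map_source he)
  have h3 := (mdiff_chart c'.tot_mem).mdifferentiableAt he'
  have h4 : MDifferentiableAt 𝓘(ℝ, B × F) 𝓘(ℝ, B × F) (c'.tot ∘ c.tot.symm) (c.tot e) :=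
    MDifferentiableAt.comp (c.tot e) (by rw [c.tot.left_inv he]; exact h3) h2
  have h5 := mfderiv_comp e h4 h1
  have h6 : c'.tot =ᶠ[𝓝 e] (c'.tot ∘ c.tot.symm) ∘ c.tot := by
    filter_upwards [c.tot.open_source.mem_nhds he] with x hx
    simp [c.tot.left_inv hx]
  have h7 := h6.mfderiv_eq (I := 𝓘(ℝ, B × F)) (I' := 𝓘(ℝ, B × F))
  rw [h5, mfderiv_eq_fderiv] at h7
  exact h7

theorem dbase_change {x : M} (hx : x ∈ c.base.source) (hx' : x ∈ c'.base.source) :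
    c'.dbase x = (fderiv ℝ (c'.base ∘ c.base.symm) (c.base x)).comp (c.dbase x) := by
  have h1 := (mdiff_chart c.base_mem).mdifferentiableAt hx
  have h2 := (mdiff_chart c.base_mem).mdifferentiableAt_symm (c.base.map_source hx)
  have h3 := (mdiff_chart c'.base_mem).mdifferentiableAt hx'
  have h4 : MDifferentiableAt 𝓘(ℝ, B) 𝓘(ℝ, B) (c'.base ∘ c.base.symm) (c.base x) :=
    MDifferentiableAt.comp (c.base x) (by rw [c.base.left_inv hx]; exact h3) h2
  have h5 := mfderiv_comp x h4 h1
  have h6 : c'.base =ᶠ[𝓝 x] (c'.base ∘ c.base.symm) ∘ c.base := by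
    filter_upwards [c.base.open_source.mem_nhds hx] with x hx
    simp [c.base.left_inv hx]
  have h7 := h6.mfderiv_eq (I := 𝓘(ℝ, B)) (I' := 𝓘(ℝ, B))
  rw [h5, mfderiv_eq_fderiv] at h7
  exact h7

theorem slope_change [IsFiberedManifold B F p] (j : Jet B F p) (he : j.pt ∈ c.tot.source)
    (he' : j.pt ∈ c'.tot.source) :
    c'.slope j = (ContinuousLinearMap.snd ℝ B F).comp
      ((fderiv ℝ (c'.tot ∘ c.tot.symm) (c.tot j.pt)).comp
        (((ContinuousLinearMap.id ℝ B).prod (c.slope j)).comp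
          (fderiv ℝ (c.base ∘ c'.base.symm) (c'.tot j.pt).1))) := by
  ext1 v
  have h1 := c.dtot_change c' he he'
  have h2 := c'.dbase_change c (c'.mapsTo _ he') (c.mapsTo _ he)
  have h3 := c.dtot_lin j he ((c'.dbase (p j.pt)).inverse v)
  have h4 := DFunLike.congr_fun (c'.dbase_inv (c'.mapsTo _ he')).1 v
  simp only [ContinuousLinearMap.comp_apply, ContinuousLinearMap.id_apply] at h4
  rw [h2, ContinuousLinearMap.comp_apply, h4, ← c'.fst_eq _ he'] at h3
  change (c'.dtot j.pt (j.lin ((c'.dbase (p j.pt)).inverse v))).2 = _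
  rw [h1, ContinuousLinearMap.comp_apply, h3]
  rfl

theorem contDiffOn_change {V N : Type*} [NormedAddCommGroup V] [NormedSpace ℝ V]
    [TopologicalSpace N] [ChartedSpace V N] [IsManifold 𝓘(ℝ, V) ∞ N]
    {φ ψ : OpenPartialHomeomorph N V} (h : φ ∈ IsManifold.maximalAtlas 𝓘(ℝ, V) ∞ N)
    (h' : ψ ∈ IsManifold.maximalAtlas 𝓘(ℝ, V) ∞ N) :
    ContDiffOn ℝ ∞ (ψ ∘ φ.symm) (φ.symm ≫ₕ ψ).source := by
  have h1 := contMDiffOn_of_mem_maximalAtlas h'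
  have h2 := contMDiffOn_symm_of_mem_maximalAtlas h
  rw [← contMDiffOn_iff_contDiffOn]
  refine h1.comp (h2.mono ?_) ?_
  · intro x hx
    simp at hx
    exact hx.1
  · intro x hx
    simp at hx
    exact hx.2

theorem jetEquiv_trans_source [IsFiberedManifold B F p] :
    (c.jetEquiv.symm.trans c'.jetEquiv).source =
      (fun z : B × (F × (B →L[ℝ] F)) => (z.1, z.2.1)) ⁻¹' (c.tot.symm ≫ₕ c'.tot).source := by
  ext z
  simp only [PartialEquiv.trans_source, PartialEquiv.symm_source, Set.mem_inter_iff,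
    Set.mem_preimage, OpenPartialHomeomorph.trans_source, OpenPartialHomeomorph.symm_source]
  refine and_congr_right fun hz => ?_
  change (c.jetEquiv.symm z).pt ∈ c'.tot.source ↔ _
  rw [c.jetEquiv_symm_pt hz]

theorem contDiffOn_jet_change [IsFiberedManifold B F p] :
    ContDiffOn ℝ ∞ (c.jetEquiv.symm.trans c'.jetEquiv)
      (c.jetEquiv.symm.trans c'.jetEquiv).source := by
  have hg := contDiffOn_change c.tot_mem c'.tot_mem
  have hk := contDiffOn_change c'.base_mem c.base_mem
  have hgo : IsOpen (c.tot.symm ≫ₕ c'.tot).source := (c.tot.symm ≫ₕ c'.tot).open_source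
  have hko : IsOpen (c'.base.symm ≫ₕ c.base).source := (c'.base.symm ≫ₕ c.base).open_source
  rw [jetEquiv_trans_source]
  set S := (fun z : B × (F × (B →L[ℝ] F)) => (z.1, z.2.1)) ⁻¹' (c.tot.symm ≫ₕ c'.tot).source
    with hS
  have hpr : ContDiffOn ℝ ∞ (fun z : B × (F × (B →L[ℝ] F)) => (z.1, z.2.1)) S := by fun_prop
  have hpm : Set.MapsTo (fun z : B × (F × (B →L[ℝ] F)) => (z.1, z.2.1)) S
    (c.tot.symm ≫ₕ c'.tot).source := fun z hz => hz
  have hgz : ContDiffOn ℝ ∞ (fun z => (c'.tot ∘ c.tot.symm) (z.1, z.2.1)) S := hg.comp hpr hpm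
  have hdg : ContDiffOn ℝ ∞ (fun z => fderiv ℝ (c'.tot ∘ c.tot.symm) (z.1, z.2.1)) S :=
    (hg.fderiv_of_isOpen hgo (by simp)).comp hpr hpm
  have hmem : ∀ z ∈ S, c.tot.symm (z.1, z.2.1) ∈ c.tot.source ∧
      c.tot.symm (z.1, z.2.1) ∈ c'.tot.source := by
    intro z hz
    have hz' : (z.1, z.2.1) ∈ (c.tot.symm ≫ₕ c'.tot).source := hz
    simp at hz'
    exact ⟨c.tot.map_target hz'.1, hz'.2⟩
  have hdk : ContDiffOn ℝ ∞ (fun z => fderiv ℝ (c.base ∘ c'.base.symm)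
      ((c'.tot ∘ c.tot.symm) (z.1, z.2.1)).1) S := by
    refine (hk.fderiv_of_isOpen hko (by simp)).comp hgz.fst ?_
    intro z hz
    obtain ⟨h1, h2⟩ := hmem z hz
    have h3 := c'.fst_eq _ h2
    have h4 := c'.mapsTo _ h2
    simp only [Function.comp_apply, h3, OpenPartialHomeomorph.trans_source,
      OpenPartialHomeomorph.symm_source, Set.mem_inter_iff, Set.mem_preimage,
      c'.base.left_inv h4]
    exact ⟨c'.base.map_source h4, c.mapsTo _ h1⟩
  have hA : ContDiffOn ℝ ∞ (fun z : B × (F × (B →L[ℝ] F)) =>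
      (ContinuousLinearMap.id ℝ B).prod z.2.2) S := by
    have : ContDiff ℝ ∞ (fun A : B →L[ℝ] F => (ContinuousLinearMap.id ℝ B).prod A) := by
      have h : (fun A : B →L[ℝ] F => (ContinuousLinearMap.id ℝ B).prod A) = fun A =>
          (ContinuousLinearMap.inl ℝ B F) +
            ContinuousLinearMap.compL ℝ B F (B × F) (ContinuousLinearMap.inr ℝ B F) A := by
        funext A
        ext v <;> simp
      rw [h]
      fun_prop
    exact this.comp_contDiffOn (by fun_prop)
  have hT : ContDiffOn ℝ ∞ (fun z : B × (F × (B →L[ℝ] F)) =>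
      (((c'.tot ∘ c.tot.symm) (z.1, z.2.1)).1, (((c'.tot ∘ c.tot.symm) (z.1, z.2.1)).2,
        (ContinuousLinearMap.snd ℝ B F).comp
          ((fderiv ℝ (c'.tot ∘ c.tot.symm) (z.1, z.2.1)).comp
            (((ContinuousLinearMap.id ℝ B).prod z.2.2).comp
              (fderiv ℝ (c.base ∘ c'.base.symm) ((c'.tot ∘ c.tot.symm) (z.1, z.2.1)).1)))))) S :=
    hgz.fst.prodMk (hgz.snd.prodMk
      (contDiffOn_const.clm_comp (hdg.clm_comp (hA.clm_comp hdk))))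
  refine hT.congr fun z hz => ?_
  obtain ⟨h1, h2⟩ := hmem z hz
  have hz' : (z.1, z.2.1) ∈ c.tot.target := by
    have hz' : (z.1, z.2.1) ∈ (c.tot.symm ≫ₕ c'.tot).source := hz
    simp at hz'
    exact hz'.1
  have h3 := c.jetEquiv_symm_pt hz'
  have h4 := c.slope_change c' (c.jetEquiv.symm z) (h3 ▸ h1) (h3 ▸ h2)
  have h5 : c.slope (c.jetEquiv.symm z) = z.2.2 :=
    congrArg (fun w => w.2.2) (c.jetEquiv.right_inv (x := z) hz')
  rw [h3, h5, c.tot.right_inv hz'] at h4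
  change ((c'.tot (c.jetEquiv.symm z).pt).1, ((c'.tot (c.jetEquiv.symm z).pt).2,
    c'.slope (c.jetEquiv.symm z))) = _
  rw [h3, h4]
  rfl

end FiberedChart

/-! ### The smooth structure of `J E` -/

section Structure

variable [IsManifold 𝓘(ℝ, B) ∞ M] [IsManifold 𝓘(ℝ, B × F) ∞ E] (p : E → M)
  [IsFiberedManifold B F p]

/-- The charts of `J E` are those induced by the fibered charts of `E`. -/
def jetCore : ChartedSpaceCore (B × (F × (B →L[ℝ] F))) (Jet B F p) where
  atlas := Set.range (fun c : FiberedChart B F p => c.jetEquiv)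
  chartAt j := (exists_fiberedChart (B := B) (F := F) p j.pt).choose.jetEquiv
  mem_chart_source j := (exists_fiberedChart (B := B) (F := F) p j.pt).choose_spec
  chart_mem_atlas j := ⟨_, rfl⟩
  open_source := by
    rintro _ _ ⟨c, rfl⟩ ⟨c', rfl⟩
    rw [c.jetEquiv_trans_source c']
    exact (c.tot.symm ≫ₕ c'.tot).open_source.preimage (by fun_prop)
  continuousOn_toFun := by
    rintro _ _ ⟨c, rfl⟩ ⟨c', rfl⟩
    exact (c.contDiffOn_jet_change c').continuousOn

instance : TopologicalSpace (Jet B F p) := (jetCore p).toTopologicalSpace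

instance : ChartedSpace (B × (F × (B →L[ℝ] F))) (Jet B F p) := (jetCore p).toChartedSpace

variable {p} in
/-- The chart `(x, y, y_a)` of `J E` induced by a fibered chart `(x, y)` of `E`. -/
def FiberedChart.jetTot (c : FiberedChart B F p) :
    OpenPartialHomeomorph (Jet B F p) (B × (F × (B →L[ℝ] F))) :=
  (jetCore p).openPartialHomeomorph c.jetEquiv ⟨c, rfl⟩

theorem mem_atlas_jet {φ : OpenPartialHomeomorph (Jet B F p) (B × (F × (B →L[ℝ] F)))} :
    φ ∈ atlas (B × (F × (B →L[ℝ] F))) (Jet B F p) ↔ ∃ c : FiberedChart B F p, φ = c.jetTot := by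
  constructor
  · intro h
    obtain ⟨_, ⟨e, rfl⟩, h⟩ := h
    obtain ⟨_, ⟨⟨c, rfl⟩, rfl⟩, h⟩ := h
    exact ⟨c, h⟩
  · rintro ⟨c, rfl⟩
    exact Set.mem_iUnion₂.2 ⟨c.jetEquiv, ⟨c, rfl⟩, rfl⟩

instance : IsManifold 𝓘(ℝ, B × (F × (B →L[ℝ] F))) ∞ (Jet B F p) := by
  refine isManifold_of_contDiffOn _ _ _ fun φ ψ hφ hψ => ?_
  obtain ⟨c, rfl⟩ := (mem_atlas_jet p).1 hφ
  obtain ⟨c', rfl⟩ := (mem_atlas_jet p).1 hψ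
  have h := c.contDiffOn_jet_change c'
  refine h.mono ?_
  intro z hz
  exact hz.1

variable {p} in
/-- The projection `J E → M`. -/
def Jet.proj (j : Jet B F p) : M := p j.pt

variable {p} in
/-- The fibered chart of `J E → M` with coordinates `(x, (y, y_a))` induced by a fibered
chart `(x, y)` of `E → M`. -/
def FiberedChart.jet (c : FiberedChart B F p) :
    FiberedChart B (F × (B →L[ℝ] F)) (Jet.proj : Jet B F p → M) where
  tot := c.jetTot
  base := c.base
  tot_mem := IsManifold.subset_maximalAtlas ((mem_atlas_jet p).2 ⟨c, rfl⟩)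
  base_mem := c.base_mem
  mapsTo j hj := c.mapsTo j.pt hj
  fst_eq j hj := c.fst_eq j.pt hj

variable {p} in
theorem FiberedChart.mkJet_mem_source (c : FiberedChart B F p) (e : E) (he : e ∈ c.tot.source)
    (A : B →L[ℝ] F) : c.mkJet e he A ∈ c.jet.tot.source := he

instance : IsFiberedManifold B (F × (B →L[ℝ] F)) (Jet.proj : Jet B F p → M) where
  surjective x := by
    obtain ⟨e, rfl⟩ := IsFiberedManifold.surjective B F (p := p) x
    obtain ⟨c, hc⟩ := exists_fiberedChart (B := B) (F := F) p e
    exact ⟨c.mkJet e hc 0, rfl⟩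
  submersion j := by
    obtain ⟨c, hc⟩ := exists_fiberedChart (B := B) (F := F) p j.pt
    refine Manifold.IsSubmersionAtOfComplement.mk_of_charts
      (ContinuousLinearEquiv.refl ℝ _) c.jet.tot c.jet.base hc (c.mapsTo _ hc) c.jet.tot_mem
      c.jet.base_mem (fun j hj => c.jet.mapsTo j hj) ?_
    intro z hz
    have hz' : z ∈ c.jet.tot.target := by simpa using hz
    have h := c.jet.fst_eq _ (c.jet.tot.map_target hz')
    rw [c.jet.tot.right_inv hz'] at h
    simpa using h.symm

variable {p} in
theorem Jet.contMDiff_pt :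
    ContMDiff 𝓘(ℝ, B × (F × (B →L[ℝ] F))) 𝓘(ℝ, B × F) ∞ (Jet.pt : Jet B F p → E) := by
  intro j
  obtain ⟨c, hc⟩ := exists_fiberedChart (B := B) (F := F) p j.pt
  have hj : j ∈ c.jet.tot.source := hc
  have h1 : ContMDiffAt 𝓘(ℝ, B × (F × (B →L[ℝ] F))) 𝓘(ℝ, B × (F × (B →L[ℝ] F))) ∞ c.jet.tot j :=
    contMDiffAt_of_mem_maximalAtlas c.jet.tot_mem hj
  have h2 : ContMDiffAt 𝓘(ℝ, B × F) 𝓘(ℝ, B × F) ∞ c.tot.symm (c.tot j.pt) :=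
    contMDiffAt_symm_of_mem_maximalAtlas c.tot_mem (c.tot.map_source hc)
  have h3 : ContMDiff 𝓘(ℝ, B × (F × (B →L[ℝ] F))) 𝓘(ℝ, B × F) ∞
      (fun z : B × (F × (B →L[ℝ] F)) => (z.1, z.2.1)) := by
    rw [contMDiff_iff_contDiff]
    fun_prop
  have h4 : ContMDiffAt 𝓘(ℝ, B × (F × (B →L[ℝ] F))) 𝓘(ℝ, B × F) ∞
      (fun j => c.tot.symm ((c.jet.tot j).1, (c.jet.tot j).2.1)) j :=
    ContMDiffAt.comp j (g := c.tot.symm) (f := fun j => ((c.jet.tot j).1, (c.jet.tot j).2.1))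
      h2 (h3.contMDiffAt.comp j h1)
  refine h4.congr_of_eventuallyEq ?_
  filter_upwards [c.jet.tot.open_source.mem_nhds hj] with k hk
  exact (c.tot.left_inv hk).symm

end Structure

/-! ### Morphisms and connections -/

section Maps

variable {F' E' : Type*} [NormedAddCommGroup F'] [NormedSpace ℝ F']
  [TopologicalSpace E'] [ChartedSpace (B × F') E'] {p : E → M} {p' : E' → M}

/-- The first jet prolongation `J f : J E → J E'` of a morphism `f : E → E'` over `M`, which
sends a jet `j` at `e` to `T_e f ∘ j`. The equality `p' (f e) = p e` serves to identify
`T_{p' (f e)} M` with `T_{p e} M`. -/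
def Jet.map [hp' : IsFiberedManifold B F' p'] (f : E → E')
    (hf : MDifferentiable 𝓘(ℝ, B × F) 𝓘(ℝ, B × F') f) (h : ∀ e, p' (f e) = p e)
    (j : Jet B F p) : Jet B F' p' where
  pt := f j.pt
  lin := (mfderiv 𝓘(ℝ, B × F) 𝓘(ℝ, B × F') f j.pt).comp (h j.pt ▸ j.lin)
  comp_lin := by
    have h1 := mfderiv_comp j.pt
      ((IsFiberedManifold.contMDiff p').mdifferentiable (by simp) (f j.pt)) (hf j.pt)
    rw [← ContinuousLinearMap.comp_assoc]
    have key : ∀ (q : E → M) (_ : q = p) (hq : q j.pt = p j.pt),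
        (mfderiv 𝓘(ℝ, B × F) 𝓘(ℝ, B) q j.pt).comp
          (hq ▸ j.lin : TangentSpace 𝓘(ℝ, B) (q j.pt) →L[ℝ] TangentSpace 𝓘(ℝ, B × F) j.pt) =
        ContinuousLinearMap.id ℝ _ := by
      rintro q rfl hq
      exact j.comp_lin
    have h2 := key (p' ∘ f) (funext h) (h j.pt)
    rw [h1] at h2
    exact h2

end Maps

section Connection

variable [IsManifold 𝓘(ℝ, B) ∞ M] [IsManifold 𝓘(ℝ, B × F) ∞ E]

variable (B F) in
/-- A connection of `p : E → M`: a smooth section `κ : E → J E` of `J E → E`. -/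
structure Connection (p : E → M) [IsFiberedManifold B F p] where
  toFun : E → Jet B F p
  contMDiff : ContMDiff 𝓘(ℝ, B × F) 𝓘(ℝ, B × (F × (B →L[ℝ] F))) ∞ toFun
  pt_toFun : ∀ e, (toFun e).pt = e

instance (p : E → M) [IsFiberedManifold B F p] :
    CoeFun (Connection B F p) (fun _ => E → Jet B F p) := ⟨Connection.toFun⟩

variable (B F) in
/-- The second iterated jet bundle `J J E`, i.e. the first jet prolongation of `J E → M`. -/
abbrev JetJet (p : E → M) [IsFiberedManifold B F p] :=
  Jet B (F × (B →L[ℝ] F)) (Jet.proj : Jet B F p → M)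

variable {p : E → M} [IsFiberedManifold B F p]

/-- The first jet prolongation `J κ : J E → J J E` of a connection `κ : E → J E`. -/
def Connection.prolong (κ : Connection B F p) : Jet B F p → JetJet B F p :=
  Jet.map κ (κ.contMDiff.mdifferentiable (by simp)) fun e => congrArg p (κ.pt_toFun e)

/-- The first jet prolongation `J p_E : J J E → J E` of the projection `p_E : J E → E`. -/
def Jet.mapPt : JetJet B F p → Jet B F p :=
  Jet.map Jet.pt (Jet.contMDiff_pt.mdifferentiable (by simp)) fun _ => rfl

end Connection

/-! ### The involution of `J J E` determined by a linear connection of `T M` -/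

section Involution

variable [FiniteDimensional ℝ B] [IsManifold 𝓘(ℝ, B) ∞ M] [IsManifold 𝓘(ℝ, B × F) ∞ E]

/-- The tangent map `T_x M → B` of a chart of `M`. -/
def chartDeriv (ψ : OpenPartialHomeomorph M B) (x : M) : TangentSpace 𝓘(ℝ, B) x →L[ℝ] B :=
  mfderiv 𝓘(ℝ, B) 𝓘(ℝ, B) ψ x

/-- The coordinate vector field `∂_v` of a chart of `M`, for a vector `v` of the model space. -/
def coordField (ψ : OpenPartialHomeomorph M B) (v : B) (x : M) : TangentSpace 𝓘(ℝ, B) x :=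
  (chartDeriv ψ x).inverse v

theorem mdifferentiableAt_coordField [CompleteSpace B] {ψ : OpenPartialHomeomorph M B}
    (h : ψ ∈ IsManifold.maximalAtlas 𝓘(ℝ, B) ∞ M) {x : M} (hx : x ∈ ψ.source) (v : B) :
    MDifferentiableAt 𝓘(ℝ, B) (𝓘(ℝ, B).prod 𝓘(ℝ, B))
      (fun x => (⟨x, coordField ψ v x⟩ : TangentBundle 𝓘(ℝ, B) M)) x := by
  have h1 : MDifferentiableAt 𝓘(ℝ, B) (𝓘(ℝ, B).prod 𝓘(ℝ, B))
      (fun y : B => (⟨y, v⟩ : TangentBundle 𝓘(ℝ, B) B)) (ψ x) := by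
    rw [mdifferentiableAt_totalSpace]
    exact ⟨mdifferentiableAt_id, by simpa using mdifferentiableAt_const⟩
  refine MDifferentiableAt.mpullback_vectorField (V := fun _ => v) h1
    (contMDiffAt_of_mem_maximalAtlas h hx) ⟨(mdiff_chart h).mfderiv hx, rfl⟩
    (n := ∞) ENat.LEInfty.out

variable (cov : CovariantDerivative 𝓘(ℝ, B) B (TangentSpace 𝓘(ℝ, B) : M → Type _))

/-- The components of a linear connection of `T M` in a chart `ψ`, at a point `x` of the chart, as
the bilinear map `(w, v) ↦ Γ_a^c_b w^a v^b ∂_c`. The sign convention is the one for which the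
horizontal lift `Γ : T M → J (T M)` has the components `Γ^c_a = Γ_a^c_b v^b`; thus
`∇_a v^c = ∂_a v^c - Γ_a^c_b v^b`, that is `∇_{∂_a} ∂_b = - Γ_a^c_b ∂_c`. -/
def connectionCoeff {ψ : OpenPartialHomeomorph M B}
    (hψ : ψ ∈ IsManifold.maximalAtlas 𝓘(ℝ, B) ∞ M) {x : M} (hx : x ∈ ψ.source) :
    B →L[ℝ] B →L[ℝ] B :=
  ContinuousLinearMap.flip <| LinearMap.toContinuousLinearMap
    { toFun := fun v =>
        -((chartDeriv ψ x).comp ((cov (coordField ψ v) x).comp (chartDeriv ψ x).inverse))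
      map_add' := fun v v' => by
        have h : coordField ψ (v + v') = coordField ψ v + coordField ψ v' :=
          funext fun y => map_add _ _ _
        rw [h, cov.isCovariantDerivativeOnUniv.add (mdifferentiableAt_coordField hψ hx v)
          (mdifferentiableAt_coordField hψ hx v')]
        ext1 w
        simp [add_comm]
      map_smul' := fun a v => by
        have h : coordField ψ (a • v) = a • coordField ψ v :=
          funext fun y => map_smul _ _ _
        rw [h, cov.isCovariantDerivativeOnUniv.smul_const a (mdifferentiableAt_coordField hψ hx v)]
        ext1 w
        simp }

theorem connectionCoeff_apply {ψ : OpenPartialHomeomorph M B}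
    (hψ : ψ ∈ IsManifold.maximalAtlas 𝓘(ℝ, B) ∞ M) {x : M} (hx : x ∈ ψ.source) (w v : B) :
    connectionCoeff cov hψ hx w v =
      -(chartDeriv ψ x (cov (coordField ψ v) x (coordField ψ w x))) := rfl

variable {p : E → M} [IsFiberedManifold B F p]

/-- The involution of `J J E` over the domain of a fibered chart `c`: the jet with coordinates
`(x, y, u_a; y_a, y_ab)` is sent to the jet with coordinates
`(x, y, y_a; u_a, y_ba + Γ_b^c_a (u_c - y_c))`. In the code, `u` is the linear map with matrix
`(u_a)`, `y₁` the one with matrix `(y_a)`, and `y₂ w v = y_ab w^b v^a`. -/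
def modugnoInvolutionIn (c : FiberedChart B F p) (X : JetJet B F p)
    (hX : X.pt.pt ∈ c.tot.source) : JetJet B F p :=
  let u : B →L[ℝ] F := c.slope X.pt
  let y₁ : B →L[ℝ] F := (ContinuousLinearMap.fst ℝ F (B →L[ℝ] F)).comp (c.jet.slope X)
  let y₂ : B →L[ℝ] B →L[ℝ] F := (ContinuousLinearMap.snd ℝ F (B →L[ℝ] F)).comp (c.jet.slope X)
  c.jet.mkJet (c.mkJet X.pt.pt hX y₁) (c.mkJet_mem_source _ hX _)
    (u.prod (y₂.flip + (ContinuousLinearMap.compL ℝ B B F (u - y₁)).comp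
      (connectionCoeff cov c.base_mem (c.mapsTo _ hX))))

/-- Modugno's involution `s_Γ : J J E → J J E`. Each point of `J J E` is mapped by means of
a fibered chart around its base point; the result does not depend on the chart. -/
def modugnoInvolution (X : JetJet B F p) : JetJet B F p :=
  modugnoInvolutionIn cov (exists_fiberedChart (B := B) (F := F) p X.pt.pt).choose X
    (exists_fiberedChart (B := B) (F := F) p X.pt.pt).choose_spec

end Involution

/-! ### Coordinates

Fibered charts take values in `B × F`; bases of `B` and `F` turn them into real coordinates. -/

section Coordinates

open Module

variable {ι ν : Type*} (bB : Basis ι ℝ B) (bF : Basis ν ℝ F)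
  [IsManifold 𝓘(ℝ, B) ∞ M] [IsManifold 𝓘(ℝ, B × F) ∞ E] {p : E → M} [IsFiberedManifold B F p]
  (c : FiberedChart B F p)

namespace FiberedChart

/-- `x^a` on `M`. -/
def coordX (a : ι) (x : M) : ℝ := bB.repr (c.base x) a

/-- `y^i` on `E`. -/
def coordY (i : ν) (e : E) : ℝ := bF.repr (c.tot e).2 i

/-- `y^i_a` on `J E`; at `X.pt`, for `X` in `J J E`, this is the coordinate `u^i_a` of `X`. -/
def coordJ (i : ν) (a : ι) (j : Jet B F p) : ℝ := bF.repr (c.slope j (bB a)) i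

/-- `y^i_a` on `J J E`, the derivative with respect to `x^a` of the coordinate `y^i` of `J E`. -/
def coordJJ₁ (i : ν) (a : ι) (X : JetJet B F p) : ℝ := bF.repr (c.jet.slope X (bB a)).1 i

/-- `y^i_ab = (y^i_a)_b` on `J J E`, the derivative with respect to `x^b` of the coordinate `y^i_a`
of `J E`. -/
def coordJJ₂ (i : ν) (a b : ι) (X : JetJet B F p) : ℝ :=
  bF.repr ((c.jet.slope X (bB b)).2 (bB a)) i

/-- The partial derivative `∂f/∂x^a` of a function on `E`. -/
def partialX (a : ι) (f : E → ℝ) (e : E) : ℝ :=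
  fderiv ℝ (f ∘ c.tot.symm) (c.tot e) (bB a, 0)

/-- The partial derivative `∂f/∂y^j` of a function on `E`. -/
def partialY (j : ν) (f : E → ℝ) (e : E) : ℝ :=
  fderiv ℝ (f ∘ c.tot.symm) (c.tot e) (0, bF j)

/-- The component `Γ_a^d_b` at the point `p e` of a linear connection of `T M`. -/
def coordΓ [FiniteDimensional ℝ B]
    (cov : CovariantDerivative 𝓘(ℝ, B) B (TangentSpace 𝓘(ℝ, B) : M → Type _))
    {e : E} (he : e ∈ c.tot.source) (a d b : ι) : ℝ :=
  bB.repr (connectionCoeff cov c.base_mem (c.mapsTo e he) (bB a) (bB b)) d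

end FiberedChart

end Coordinates

end Basic

end JetBundle

end

open JetBundle Module

/-! The heart of the matter is that the formula defining `s_Γ` in one fibered chart is the same in
every other. Let g be the change of charts of E from old to new, h the change of base charts from
new to old, and write a point of JJE as (x, y, u; y₁, y₂) with u, y₁ linear and y₂ bilinear. By
`jet_slope_change_apply`, u and y₁ transform in the same way, while the law for y₂ contains D²g
evaluated on (w, y₁ w) and (v, u v), with w and v in old coordinates, a tensorial term in y₂, and an
inhomogeneous term containing D²h, to which u is applied. Exchanging u with y₁ and transposing y₂
preserves all of this, by symmetry of second derivatives, except that u(D²h) has become y₁(D²h). The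
defect (u - y₁)(D²h) is cancelled by the correction (u - y₁)(Γ), because Γ has an inhomogeneous term
-D²h under a change of charts (`connectionCoeff_change`). This is `modugnoInvolutionIn_change`; it
holds for any linear connection.

Torsion-freeness enters only in the involutivity: applying the formula twice adds (u - y₁) of the
antisymmetric part of Γ, which vanishes by `connectionCoeff_symm`, since coordinate fields commute.

Because `s_Γ` exchanges the two projections JJE → JE, namely the base point and J p_E, the claims on
κ' = s_Γ ∘ Jκ are formal: J p_E ∘ Jκ = J(p_E ∘ κ) = id makes κ' a section, and the base point of
Jκ(u) being κ(p_E u) makes it projectable. The coordinate expression follows by differentiating the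
graph z ↦ (z, κ(z)) (`jet_slope_prolong`). -/

namespace JetBundle

/-! ### Coordinate vector fields of a chart of M. -/

section ChartFields

variable {B M : Type*} [NormedAddCommGroup B] [NormedSpace ℝ B] [TopologicalSpace M]
  [ChartedSpace B M] [IsManifold 𝓘(ℝ, B) ∞ M] {ψ : OpenPartialHomeomorph M B}

theorem chartDeriv_isInvertible (h : ψ ∈ IsManifold.maximalAtlas 𝓘(ℝ, B) ∞ M) {x : M}
    (hx : x ∈ ψ.source) : (chartDeriv ψ x).IsInvertible :=
  ⟨(mdiff_chart h).mfderiv hx, rfl⟩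

theorem chartDeriv_inverse_apply (h : ψ ∈ IsManifold.maximalAtlas 𝓘(ℝ, B) ∞ M) {x : M}
    (hx : x ∈ ψ.source) (v : B) : chartDeriv ψ x ((chartDeriv ψ x).inverse v) = v := by
  obtain ⟨L, hL⟩ := chartDeriv_isInvertible h hx
  rw [← hL]
  simp

theorem inverse_chartDeriv_apply (h : ψ ∈ IsManifold.maximalAtlas 𝓘(ℝ, B) ∞ M) {x : M}
    (hx : x ∈ ψ.source) (v : TangentSpace 𝓘(ℝ, B) x) :
    (chartDeriv ψ x).inverse (chartDeriv ψ x v) = v := by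
  obtain ⟨L, hL⟩ := chartDeriv_isInvertible h hx
  rw [← hL]
  simp

/-- A coordinate field is the pullback by the chart of a constant field, and pullback by a local
diffeomorphism preserves smoothness. -/
theorem contMDiffAt_coordField [CompleteSpace B]
    (h : ψ ∈ IsManifold.maximalAtlas 𝓘(ℝ, B) ∞ M) {x : M} (hx : x ∈ ψ.source) (v : B) :
    ContMDiffAt 𝓘(ℝ, B) (𝓘(ℝ, B).prod 𝓘(ℝ, B)) ∞
      (fun x => (⟨x, coordField ψ v x⟩ : TangentBundle 𝓘(ℝ, B) M)) x := by
  have h1 : ContMDiffAt 𝓘(ℝ, B) (𝓘(ℝ, B).prod 𝓘(ℝ, B)) ∞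
      (fun y : B => (⟨y, v⟩ : TangentBundle 𝓘(ℝ, B) B)) (ψ x) :=
    contMDiffAt_vectorSpace_iff_contDiffAt.2 contDiffAt_const
  exact ContMDiffAt.mpullback_vectorField_preimage (V := fun _ => v) h1
    (contMDiffAt_of_mem_maximalAtlas h hx) (chartDeriv_isInvertible h hx) (by simp)

/-- The components are the fiber part of the tangent map of the chart composed with the field, and
that tangent map is smooth over the chart domain. -/
theorem contMDiffAt_chartDeriv_apply (h : ψ ∈ IsManifold.maximalAtlas 𝓘(ℝ, B) ∞ M) {x : M}
    (hx : x ∈ ψ.source) {W : ∀ x : M, TangentSpace 𝓘(ℝ, B) x}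
    (hW : ContMDiffAt 𝓘(ℝ, B) (𝓘(ℝ, B).prod 𝓘(ℝ, B)) ∞
      (fun x => (⟨x, W x⟩ : TangentBundle 𝓘(ℝ, B) M)) x) :
    ContMDiffAt 𝓘(ℝ, B) 𝓘(ℝ, B) ∞ (fun x => chartDeriv ψ x (W x)) x := by
  have h1 := (contMDiffOn_of_mem_maximalAtlas h).contMDiffOn_tangentMapWithin (m := ∞) (by simp)
    ψ.open_source.uniqueMDiffOn
  have h2 : ContMDiffAt (𝓘(ℝ, B).prod 𝓘(ℝ, B)) (𝓘(ℝ, B).prod 𝓘(ℝ, B)) ∞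
      (tangentMapWithin 𝓘(ℝ, B) 𝓘(ℝ, B) ψ ψ.source)
      (⟨x, W x⟩ : TangentBundle 𝓘(ℝ, B) M) :=
    h1.contMDiffAt ((ψ.open_source.preimage
      (FiberBundle.continuous_proj B (TangentSpace 𝓘(ℝ, B)))).mem_nhds hx)
  have h3 := (contMDiff_snd_tangentBundle_modelSpace B 𝓘(ℝ, B)).contMDiffAt.comp x (h2.comp x hW)
  refine h3.congr_of_eventuallyEq ?_
  filter_upwards [ψ.open_source.mem_nhds hx] with y hy
  exact DFunLike.congr_fun (mfderivWithin_of_isOpen ψ.open_source hy).symm (W y)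

/-- The Lie bracket is natural under pullback, and constant fields on the model space commute. This
is what turns vanishing torsion into symmetry of the components of Γ. -/
theorem mlieBracket_coordField [CompleteSpace B] (h : ψ ∈ IsManifold.maximalAtlas 𝓘(ℝ, B) ∞ M)
    {x : M} (hx : x ∈ ψ.source) (v w : B) :
    VectorField.mlieBracket 𝓘(ℝ, B) (coordField ψ v) (coordField ψ w) x = 0 := by
  have h1 : ∀ v : B, MDifferentiableAt 𝓘(ℝ, B) (𝓘(ℝ, B).prod 𝓘(ℝ, B))
      (fun y : B => (⟨y, v⟩ : TangentBundle 𝓘(ℝ, B) B)) (ψ x) := fun v =>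
    ContMDiffAt.mdifferentiableAt (n := 1)
      (contMDiffAt_vectorSpace_iff_contDiffAt.2 contDiffAt_const) (by simp)
  have hM : IsManifold 𝓘(ℝ, B) (minSmoothness ℝ 2) M := by
    rw [minSmoothness_of_isRCLikeNormedField]
    infer_instance
  have h2 := VectorField.mpullback_mlieBracket (I := 𝓘(ℝ, B)) (I' := 𝓘(ℝ, B)) (h1 v) (h1 w)
    (contMDiffAt_of_mem_maximalAtlas h hx) (n := ∞) (by
      rw [minSmoothness_of_isRCLikeNormedField]
      exact ENat.LEInfty.out)
  refine h2.symm.trans ?_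
  have h3 : ∀ V W : ∀ y : B, TangentSpace 𝓘(ℝ, B) y, VectorField.mlieBracket 𝓘(ℝ, B) V W (ψ x) =
      VectorField.lieBracket ℝ V W (ψ x) := fun V W => by
    rw [← VectorField.mlieBracketWithin_univ, VectorField.mlieBracketWithin_eq_lieBracketWithin]
    exact congrFun VectorField.lieBracketWithin_univ (ψ x)
  have h4 := (h3 (fun _ => v) (fun _ => w)).trans
    (show VectorField.lieBracket ℝ (fun _ => v) (fun _ => w) (ψ x) = 0 by
      simp [VectorField.lieBracket])
  exact (congrArg (mfderiv 𝓘(ℝ, B) 𝓘(ℝ, B) ψ x).inverse h4).trans (map_zero _)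

theorem chartDeriv_change {ψ' : OpenPartialHomeomorph M B}
    (hψ : ψ ∈ IsManifold.maximalAtlas 𝓘(ℝ, B) ∞ M)
    (hψ' : ψ' ∈ IsManifold.maximalAtlas 𝓘(ℝ, B) ∞ M) {x : M}
    (hx : x ∈ ψ.source) (hx' : x ∈ ψ'.source) (v : TangentSpace 𝓘(ℝ, B) x) :
    chartDeriv ψ x v = fderiv ℝ (ψ ∘ ψ'.symm) (ψ' x) (chartDeriv ψ' x v) := by
  have h1 := (mdiff_chart hψ').mdifferentiableAt hx'
  have h2 := (mdiff_chart hψ').mdifferentiableAt_symm (ψ'.map_source hx')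
  have h3 := (mdiff_chart hψ).mdifferentiableAt hx
  have h4 : MDifferentiableAt 𝓘(ℝ, B) 𝓘(ℝ, B) (ψ ∘ ψ'.symm) (ψ' x) :=
    MDifferentiableAt.comp (ψ' x) (by rw [ψ'.left_inv hx']; exact h3) h2
  have h5 := mfderiv_comp x h4 h1
  have h6 : ψ =ᶠ[𝓝 x] (ψ ∘ ψ'.symm) ∘ ψ' := by
    filter_upwards [ψ'.open_source.mem_nhds hx'] with y hy
    simp [ψ'.left_inv hy]
  have h7 := h6.mfderiv_eq (I := 𝓘(ℝ, B)) (I' := 𝓘(ℝ, B))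
  rw [h5, mfderiv_eq_fderiv] at h7
  exact DFunLike.congr_fun h7 v

theorem coordField_change {ψ' : OpenPartialHomeomorph M B}
    (hψ : ψ ∈ IsManifold.maximalAtlas 𝓘(ℝ, B) ∞ M)
    (hψ' : ψ' ∈ IsManifold.maximalAtlas 𝓘(ℝ, B) ∞ M) {x : M}
    (hx : x ∈ ψ.source) (hx' : x ∈ ψ'.source) (v : B) :
    coordField ψ' v x = coordField ψ (fderiv ℝ (ψ ∘ ψ'.symm) (ψ' x) v) x := by
  have h := chartDeriv_change hψ hψ' hx hx' (coordField ψ' v x)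
  have h1 : chartDeriv ψ' x (coordField ψ' v x) = v := chartDeriv_inverse_apply hψ' hx' v
  rw [h1] at h
  rw [← h]
  exact (inverse_chartDeriv_apply hψ hx _).symm

end ChartFields

/-! ### Components of a linear connection: symmetry, transformation law, smoothness. -/

section ConnectionCoeff

variable {B M : Type*} [NormedAddCommGroup B] [NormedSpace ℝ B] [FiniteDimensional ℝ B]
  [TopologicalSpace M] [ChartedSpace B M] [IsManifold 𝓘(ℝ, B) ∞ M]
  {ψ : OpenPartialHomeomorph M B}
  (cov : CovariantDerivative 𝓘(ℝ, B) B (TangentSpace 𝓘(ℝ, B) : M → Type _))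

theorem connectionCoeff_symm (hcov : cov.torsion = 0)
    (hψ : ψ ∈ IsManifold.maximalAtlas 𝓘(ℝ, B) ∞ M) {x : M} (hx : x ∈ ψ.source) (v w : B) :
    connectionCoeff cov hψ hx v w = connectionCoeff cov hψ hx w v := by
  have := FiniteDimensional.complete ℝ B
  have h := cov.torsion_eq_zero_iff.1 hcov (mdifferentiableAt_coordField hψ hx v)
    (mdifferentiableAt_coordField hψ hx w)
  rw [mlieBracket_coordField hψ hx, sub_eq_zero] at h
  rw [connectionCoeff_apply, connectionCoeff_apply, h]

/-- The Leibniz rule for a vector field with variable components `f` in a chart. -/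
theorem cov_coordField (hψ : ψ ∈ IsManifold.maximalAtlas 𝓘(ℝ, B) ∞ M) {x : M}
    (hx : x ∈ ψ.source) {f : M → B} (hf : MDifferentiableAt 𝓘(ℝ, B) 𝓘(ℝ, B) f x) :
    MDifferentiableAt 𝓘(ℝ, B) (𝓘(ℝ, B).prod 𝓘(ℝ, B))
      (fun y => (⟨y, coordField ψ (f y) y⟩ : TangentBundle 𝓘(ℝ, B) M)) x ∧
    ∀ w : TangentSpace 𝓘(ℝ, B) x, cov (fun y => coordField ψ (f y) y) x w =
      cov (coordField ψ (f x)) x w +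
        (chartDeriv ψ x).inverse (mvfderiv 𝓘(ℝ, B) f x w) := by
  have := FiniteDimensional.complete ℝ B
  -- The claim is additive in f, and for f = a • v with v constant it is the Leibniz rule; a basis
  -- of B reduces the general case to these. The differentiability of f and of the section belongs
  -- to the induction predicate because additivity of `cov` and of the derivative needs it.
  let P : (M → B) → Prop := fun f => MDifferentiableAt 𝓘(ℝ, B) 𝓘(ℝ, B) f x ∧
    MDifferentiableAt 𝓘(ℝ, B) (𝓘(ℝ, B).prod 𝓘(ℝ, B))
      (fun y => (⟨y, coordField ψ (f y) y⟩ : TangentBundle 𝓘(ℝ, B) M)) x ∧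
    ∀ w : TangentSpace 𝓘(ℝ, B) x, cov (fun y => coordField ψ (f y) y) x w =
      cov (coordField ψ (f x)) x w +
        (chartDeriv ψ x).inverse (mvfderiv 𝓘(ℝ, B) f x w)
  suffices h : P f from h.2
  have hadd : ∀ f g, P f → P g → P (f + g) := by
    rintro f g ⟨hf, hf', hf''⟩ ⟨hg, hg', hg''⟩
    have h1 : (fun y => coordField ψ ((f + g) y) y) =
        (fun y => coordField ψ (f y) y) + fun y => coordField ψ (g y) y :=
      funext fun y => map_add _ _ _
    have h2 : coordField ψ ((f + g) x) = coordField ψ (f x) + coordField ψ (g x) :=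
      funext fun y => map_add _ _ _
    refine ⟨hf.add hg, ?_, fun w => ?_⟩
    · have := mdifferentiableAt_add_section hf' hg'
      rw [← h1] at this
      exact this
    · rw [h1, h2, cov.isCovariantDerivativeOnUniv.add hf' hg',
        cov.isCovariantDerivativeOnUniv.add (mdifferentiableAt_coordField hψ hx _)
          (mdifferentiableAt_coordField hψ hx _), mvfderiv_add hf hg]
      simp only [add_apply, hf'' w, hg'' w, map_add]
      abel
  have hsmul : ∀ (a : M → ℝ) (v : B), MDifferentiableAt 𝓘(ℝ, B) 𝓘(ℝ, ℝ) a x →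
      P (fun y => a y • v) := by
    intro a v ha
    have h1 : (fun y => coordField ψ (a y • v) y) = a • coordField ψ v :=
      funext fun y => map_smul _ _ _
    have h2 : coordField ψ (a x • v) = a x • coordField ψ v :=
      funext fun y => map_smul _ _ _
    have hv := mdifferentiableAt_coordField hψ hx v
    refine ⟨ha.smul mdifferentiableAt_const, ?_, fun w => ?_⟩
    · have := ha.smul_section hv
      rw [← h1] at this
      exact this
    · rw [h1, h2, cov.isCovariantDerivativeOnUniv.leibniz hv ha,
        cov.isCovariantDerivativeOnUniv.smul_const _ hv]
      have h3 := mvfderiv_fun_smul ha (mdifferentiableAt_const (c := v))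
      rw [mvfderiv_const, smul_zero, zero_add] at h3
      rw [h3]
      simp [coordField]
  let b := finBasis ℝ B
  have hfb : f = ∑ i, fun y => b.repr (f y) i • b i := by
    funext y
    rw [Finset.sum_apply]
    exact (b.sum_repr (f y)).symm
  rw [hfb]
  refine Finset.sum_induction _ P hadd ?_ ?_
  -- The zero function, for the empty sum, is the scalar 0 times the vector 0.
  · have := hsmul 0 0 mdifferentiableAt_const
    simp only [smul_zero] at this
    exact this
  · intro i _
    exact hsmul _ _ ((LinearMap.toContinuousLinearMap (b.coord i)).contMDiff.mdifferentiable
      one_ne_zero _ |>.comp x hf)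

/-- The transformation law of the components of a linear connection under a change of charts. -/
theorem connectionCoeff_change {ψ' : OpenPartialHomeomorph M B}
    (hψ : ψ ∈ IsManifold.maximalAtlas 𝓘(ℝ, B) ∞ M)
    (hψ' : ψ' ∈ IsManifold.maximalAtlas 𝓘(ℝ, B) ∞ M) {x : M}
    (hx : x ∈ ψ.source) (hx' : x ∈ ψ'.source) (w v : B) :
    fderiv ℝ (ψ ∘ ψ'.symm) (ψ' x) (connectionCoeff cov hψ' hx' w v) =
      connectionCoeff cov hψ hx (fderiv ℝ (ψ ∘ ψ'.symm) (ψ' x) w)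
          (fderiv ℝ (ψ ∘ ψ'.symm) (ψ' x) v) -
        fderiv ℝ (fderiv ℝ (ψ ∘ ψ'.symm)) (ψ' x) w v := by
  have := FiniteDimensional.complete ℝ B
  set h : B → B := ψ ∘ ψ'.symm
  have hmem : ψ' x ∈ (ψ'.symm ≫ₕ ψ).source := by
    simp [ψ'.map_source hx', ψ'.left_inv hx', hx]
  have hsm : DifferentiableAt ℝ (fderiv ℝ h) (ψ' x) :=
    (((FiberedChart.contDiffOn_change hψ' hψ).fderiv_of_isOpen (m := ∞)
      (ψ'.symm ≫ₕ ψ).open_source (by simp)).contDiffAt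
        ((ψ'.symm ≫ₕ ψ).open_source.mem_nhds hmem)).differentiableAt (by simp)
  have hψx := (mdiff_chart hψ').mdifferentiableAt hx'
  have hg : DifferentiableAt ℝ (fun z => fderiv ℝ h z v) (ψ' x) :=
    hsm.clm_apply (differentiableAt_const v)
  -- The components of the ψ'-coordinate field of v in the chart ψ. They vary with the point, so the
  -- Leibniz rule contributes their derivative, which is the D²h term.
  let f : M → B := fun y => fderiv ℝ h (ψ' y) v
  have hf : MDifferentiableAt 𝓘(ℝ, B) 𝓘(ℝ, B) f x := hg.mdifferentiableAt.comp x hψx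
  have hdf : ∀ u : TangentSpace 𝓘(ℝ, B) x, mvfderiv 𝓘(ℝ, B) f x u =
      fderiv ℝ (fderiv ℝ h) (ψ' x) (chartDeriv ψ' x u) v := by
    intro u
    have h1 := mfderiv_comp x hg.mdifferentiableAt hψx
    rw [mfderiv_eq_fderiv, fderiv_clm_apply hsm (differentiableAt_const v)] at h1
    refine (DFunLike.congr_fun h1 u).trans ?_
    simp only [fderiv_fun_const, Pi.zero_apply, ContinuousLinearMap.comp_zero, zero_add]
    rfl
  obtain ⟨hd, hcov⟩ := cov_coordField cov hψ hx hf
  have hev : ∀ᶠ y in 𝓝 x, coordField ψ' v y = coordField ψ (f y) y := by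
    filter_upwards [ψ.open_source.mem_nhds hx, ψ'.open_source.mem_nhds hx'] with y hy hy'
    exact coordField_change hψ hψ' hy hy' v
  have hcongr := cov.isCovariantDerivativeOnUniv.congr_of_eventuallyEq
    (mdifferentiableAt_coordField hψ' hx' v) hd Filter.univ_mem hev
  have h2 : chartDeriv ψ' x (coordField ψ' w x) = w := chartDeriv_inverse_apply hψ' hx' w
  rw [connectionCoeff_apply, connectionCoeff_apply, map_neg, ← chartDeriv_change hψ hψ' hx hx',
    hcongr, hcov, hdf, h2, map_add, chartDeriv_inverse_apply hψ hx,
    coordField_change hψ hψ' hx hx' w]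
  simp only [f]
  abel

/-- The components of a smooth linear connection are smooth functions. -/
theorem contMDiffAt_connectionCoeff_apply [T2Space M] [cov.ContMDiffCovariantDerivative ∞]
    (hψ : ψ ∈ IsManifold.maximalAtlas 𝓘(ℝ, B) ∞ M) {x : M} (hx : x ∈ ψ.source) (w v : B) :
    ContMDiffAt 𝓘(ℝ, B) 𝓘(ℝ, B) ∞
      (fun y => -(chartDeriv ψ y (cov (coordField ψ v) y (coordField ψ w y)))) x := by
  have := FiniteDimensional.complete ℝ B
  -- Smoothness of `cov` is applied here to globally smooth fields, so the coordinate field is cut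
  -- off by a bump function supported in the chart domain. Locality of `cov` shows that nothing
  -- changes near x, where the bump function is 1.
  obtain ⟨ρ, hρ, -⟩ := (SmoothBumpFunction.nhds_basis_support (I := 𝓘(ℝ, B))
    (ψ.open_source.mem_nhds hx)).mem_iff.1 (ψ.open_source.mem_nhds hx)
  let V : ∀ y : M, TangentSpace 𝓘(ℝ, B) y := (ρ : M → ℝ) • coordField ψ v
  have hV : ContMDiff 𝓘(ℝ, B) (𝓘(ℝ, B).prod 𝓘(ℝ, B)) ∞
      (fun y => (⟨y, V y⟩ : TangentBundle 𝓘(ℝ, B) M)) :=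
    ContMDiffOn.smul_section_of_tsupport ρ.contMDiff.contMDiffOn ψ.open_source hρ
      fun y hy => (contMDiffAt_coordField hψ hy v).contMDiffWithinAt
  have hcov := (CovariantDerivative.ContMDiffCovariantDerivative.contMDiff (cov := cov)
    (k := ∞)).contMDiff (σ := V) (by simpa using hV.contMDiffOn)
  have hVw := (hcov.contMDiffAt Filter.univ_mem).clm_bundle_apply (x := x)
    (contMDiffAt_coordField hψ hx w)
  refine (contMDiffAt_chartDeriv_apply hψ hx hVw).neg.congr_of_eventuallyEq ?_
  filter_upwards [ψ.open_source.mem_nhds hx, ρ.eventuallyEq_one.eventually_nhds] with y hy hy'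
  have h1 : cov (coordField ψ v) y = cov V y := by
    refine cov.isCovariantDerivativeOnUniv.congr_of_eventuallyEq
      (mdifferentiableAt_coordField hψ hy v) (hV.mdifferentiable (by simp) y) Filter.univ_mem ?_
    filter_upwards [hy'] with z hz
    simp [V, hz]
  rw [h1]

end ConnectionCoeff

/-! ### Changes of fibered charts on JE and JJE. -/

section CoordinateChange

variable {B F : Type*} [NormedAddCommGroup B] [NormedSpace ℝ B]
  [NormedAddCommGroup F] [NormedSpace ℝ F]
  {M E : Type*} [TopologicalSpace M] [ChartedSpace B M]
  [TopologicalSpace E] [ChartedSpace (B × F) E]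
  [IsManifold 𝓘(ℝ, B) ∞ M] [IsManifold 𝓘(ℝ, B × F) ∞ E] {p : E → M} [IsFiberedManifold B F p]

namespace FiberedChart

variable (c c' : FiberedChart B F p)

/-- Injectivity of the induced chart of JE. It makes it possible to compare jets through coordinates
without identifying tangent spaces at propositionally equal points. -/
theorem jet_ext {j k : Jet B F p} (hj : j.pt ∈ c.tot.source) (hpt : k.pt = j.pt)
    (h : c.slope k = c.slope j) : k = j := by
  refine c.jetEquiv.injOn (hpt ▸ hj : k.pt ∈ c.tot.source) hj ?_
  change ((c.tot k.pt).1, ((c.tot k.pt).2, c.slope k)) = _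
  rw [hpt, h]
  rfl

theorem jetJet_ext {X Y : JetJet B F p} (hX : X.pt.pt ∈ c.tot.source) (hpt : Y.pt.pt = X.pt.pt)
    (h : c.slope Y.pt = c.slope X.pt) (h' : c.jet.slope Y = c.jet.slope X) : Y = X :=
  c.jet.jet_ext hX (c.jet_ext hX hpt h) h'

theorem jet_tot_apply (j : Jet B F p) :
    c.jet.tot j = ((c.tot j.pt).1, ((c.tot j.pt).2, c.slope j)) := rfl

theorem jet_tot_symm_pt {z : B × (F × (B →L[ℝ] F))} (hz : (z.1, z.2.1) ∈ c.tot.target) :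
    (c.jet.tot.symm z).pt = c.tot.symm (z.1, z.2.1) := c.jetEquiv_symm_pt hz

theorem slope_jet_tot_symm {z : B × (F × (B →L[ℝ] F))} (hz : (z.1, z.2.1) ∈ c.tot.target) :
    c.slope (c.jet.tot.symm z) = z.2.2 :=
  congrArg (fun w => w.2.2) (c.jetEquiv.right_inv (x := z) hz)

theorem fst_tot_change {z : B × F} (hz : z ∈ (c.tot.symm ≫ₕ c'.tot).source) :
    ((c'.tot ∘ c.tot.symm) z).1 = c'.base (p (c.tot.symm z)) :=
  c'.fst_eq _ hz.2

theorem slope_change_apply (j : Jet B F p) (he : j.pt ∈ c.tot.source)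
    (he' : j.pt ∈ c'.tot.source) (v : B) :
    c'.slope j v = (fderiv ℝ (c'.tot ∘ c.tot.symm) (c.tot j.pt)
      (fderiv ℝ (c.base ∘ c'.base.symm) (c'.base (p j.pt)) v,
        c.slope j (fderiv ℝ (c.base ∘ c'.base.symm) (c'.base (p j.pt)) v))).2 := by
  rw [c.slope_change c' j he he', c'.fst_eq _ he']
  rfl

/-- The derivative of the change of fibered charts covers that of the change of base charts. -/
theorem fst_fderiv_tot_change {e : E} (he : e ∈ c.tot.source) (he' : e ∈ c'.tot.source)
    (v : B) (a : F) :
    (fderiv ℝ (c'.tot ∘ c.tot.symm) (c.tot e)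
      (fderiv ℝ (c.base ∘ c'.base.symm) (c'.base (p e)) v, a)).1 = v := by
  set v₀ := fderiv ℝ (c.base ∘ c'.base.symm) (c'.base (p e)) v
  -- The chart-level vector is lifted to a tangent vector ξ of E; both base components are then read
  -- off from the projection of ξ to M, which is the coordinate vector of v in the new base chart.
  obtain ⟨ξ, hξ⟩ : ∃ ξ, c.dtot e ξ = (v₀, a) :=
    ⟨(c.dtot e).inverse (v₀, a), DFunLike.congr_fun (c.dtot_inv he).1 _⟩
  have h1 := DFunLike.congr_fun (c.dtot_change c' he he') ξ
  have h2 := DFunLike.congr_fun (c'.fst_dtot he') ξ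
  have h3 := DFunLike.congr_fun (c.fst_dtot he) ξ
  simp only [ContinuousLinearMap.comp_apply, ContinuousLinearMap.coe_fst', hξ] at h1 h2 h3
  rw [← h1, h2]
  have h4 := congrArg (chartDeriv c.base (p e)).inverse h3
  have h5 := inverse_chartDeriv_apply c.base_mem (c.mapsTo e he)
    (mfderiv 𝓘(ℝ, B × F) 𝓘(ℝ, B) p e ξ)
  have h6 := coordField_change c.base_mem c'.base_mem (c.mapsTo e he) (c'.mapsTo e he') v
  have h7 : mfderiv 𝓘(ℝ, B × F) 𝓘(ℝ, B) p e ξ = coordField c'.base v (p e) :=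
    h5.symm.trans (h4.symm.trans h6.symm)
  rw [h7]
  exact chartDeriv_inverse_apply c'.base_mem (c'.mapsTo e he') v

theorem differentiableAt_fderiv_change {V N : Type*} [NormedAddCommGroup V] [NormedSpace ℝ V]
    [TopologicalSpace N] [ChartedSpace V N] [IsManifold 𝓘(ℝ, V) ∞ N]
    {φ ψ : OpenPartialHomeomorph N V} (h : φ ∈ IsManifold.maximalAtlas 𝓘(ℝ, V) ∞ N)
    (h' : ψ ∈ IsManifold.maximalAtlas 𝓘(ℝ, V) ∞ N) {x : N} (hx : x ∈ φ.source)
    (hx' : x ∈ ψ.source) :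
    DifferentiableAt ℝ (ψ ∘ φ.symm) (φ x) ∧ DifferentiableAt ℝ (fderiv ℝ (ψ ∘ φ.symm)) (φ x) := by
  have hmem : φ x ∈ (φ.symm ≫ₕ ψ).source := by
    simp [φ.map_source hx, φ.left_inv hx, hx']
  have hnhds := (φ.symm ≫ₕ ψ).open_source.mem_nhds hmem
  exact ⟨((contDiffOn_change h h').contDiffAt hnhds).differentiableAt (by simp),
    (((contDiffOn_change h h').fderiv_of_isOpen (m := ∞)
      (φ.symm ≫ₕ ψ).open_source (by simp)).contDiffAt hnhds).differentiableAt (by simp)⟩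

theorem fderiv_fderiv_change_symm {V N : Type*} [NormedAddCommGroup V] [NormedSpace ℝ V]
    [TopologicalSpace N] [ChartedSpace V N] [IsManifold 𝓘(ℝ, V) ∞ N]
    {φ ψ : OpenPartialHomeomorph N V} (h : φ ∈ IsManifold.maximalAtlas 𝓘(ℝ, V) ∞ N)
    (h' : ψ ∈ IsManifold.maximalAtlas 𝓘(ℝ, V) ∞ N) {x : N} (hx : x ∈ φ.source)
    (hx' : x ∈ ψ.source) (v w : V) :
    fderiv ℝ (fderiv ℝ (ψ ∘ φ.symm)) (φ x) v w = fderiv ℝ (fderiv ℝ (ψ ∘ φ.symm)) (φ x) w v := by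
  have hmem : φ x ∈ (φ.symm ≫ₕ ψ).source := by
    simp [φ.map_source hx, φ.left_inv hx, hx']
  refine ((contDiffOn_change h h').contDiffAt
    ((φ.symm ≫ₕ ψ).open_source.mem_nhds hmem)).isSymmSndFDerivAt ?_ v w
  rw [minSmoothness_of_isRCLikeNormedField]
  exact ENat.LEInfty.out

/-- The transformation law of the coordinates `(y_a, y_ab)` of `J J E` under a change of fibered
charts. -/
theorem jet_slope_change_apply (X : JetJet B F p) (he : X.pt.pt ∈ c.tot.source)
    (he' : X.pt.pt ∈ c'.tot.source) (w : B) :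
    (c'.jet.slope X w).1 = (fderiv ℝ (c'.tot ∘ c.tot.symm) (c.tot X.pt.pt)
      (fderiv ℝ (c.base ∘ c'.base.symm) (c'.base (p X.pt.pt)) w,
        (c.jet.slope X (fderiv ℝ (c.base ∘ c'.base.symm) (c'.base (p X.pt.pt)) w)).1)).2 ∧
    ∀ v, (c'.jet.slope X w).2 v =
      (fderiv ℝ (fderiv ℝ (c'.tot ∘ c.tot.symm)) (c.tot X.pt.pt)
        (fderiv ℝ (c.base ∘ c'.base.symm) (c'.base (p X.pt.pt)) w,
          (c.jet.slope X (fderiv ℝ (c.base ∘ c'.base.symm) (c'.base (p X.pt.pt)) w)).1)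
        (fderiv ℝ (c.base ∘ c'.base.symm) (c'.base (p X.pt.pt)) v,
          c.slope X.pt (fderiv ℝ (c.base ∘ c'.base.symm) (c'.base (p X.pt.pt)) v)) +
      fderiv ℝ (c'.tot ∘ c.tot.symm) (c.tot X.pt.pt)
        (fderiv ℝ (fderiv ℝ (c.base ∘ c'.base.symm)) (c'.base (p X.pt.pt)) w v,
          (c.jet.slope X (fderiv ℝ (c.base ∘ c'.base.symm) (c'.base (p X.pt.pt)) w)).2
            (fderiv ℝ (c.base ∘ c'.base.symm) (c'.base (p X.pt.pt)) v) +
          c.slope X.pt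
            (fderiv ℝ (fderiv ℝ (c.base ∘ c'.base.symm)) (c'.base (p X.pt.pt)) w v))).2 := by
  set e := X.pt.pt
  set g := c'.tot ∘ c.tot.symm with hg_def
  set h := c.base ∘ c'.base.symm
  set x' := c'.base (p e)
  set u := c.slope X.pt
  obtain ⟨hg, hdg⟩ : DifferentiableAt ℝ g (c.tot e) ∧ DifferentiableAt ℝ (fderiv ℝ g) (c.tot e) :=
    differentiableAt_fderiv_change c.tot_mem c'.tot_mem he he'
  obtain ⟨-, hdh⟩ : DifferentiableAt ℝ h x' ∧ DifferentiableAt ℝ (fderiv ℝ h) x' :=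
    differentiableAt_fderiv_change c'.base_mem c.base_mem (c'.mapsTo e he') (c.mapsTo e he)
  have hgx : (g (c.tot e)).1 = x' := by
    simp only [hg_def, Function.comp_apply, c.tot.left_inv he]
    exact c'.fst_eq e he'
  -- JE → M is itself fibered, with charts `c.jet` and `c'.jet`, so the first-order law applies to X
  -- with Ψ in place of g. It remains to differentiate the components of Ψ.
  set Ψ := c'.jet.tot ∘ c.jet.tot.symm
  have hΨ : DifferentiableAt ℝ Ψ (c.jet.tot X.pt) :=
    (differentiableAt_fderiv_change c.jet.tot_mem c'.jet.tot_mem he he').1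
  have hs := c.jet.slope_change_apply c'.jet X he he' w
  change c'.jet.slope X w = (fderiv ℝ Ψ (c.jet.tot X.pt)
    (fderiv ℝ h x' w, c.jet.slope X (fderiv ℝ h x' w))).2 at hs
  set w₀ := fderiv ℝ h x' w
  set a := (c.jet.slope X w₀).1
  set A := (c.jet.slope X w₀).2
  -- Because of this identity, the derivative of Dh along the curve of new base points is D²h in the
  -- direction w itself.
  have hd1 : (fderiv ℝ g (c.tot e) (w₀, a)).1 = w := c.fst_fderiv_tot_change c' he he' w a
  -- the projection `J E → E` in coordinates
  let π : B × (F × (B →L[ℝ] F)) →L[ℝ] B × F :=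
    (ContinuousLinearMap.fst ℝ B _).prod
      ((ContinuousLinearMap.fst ℝ F _).comp (ContinuousLinearMap.snd ℝ B _))
  have hπ : HasFDerivAt π π (c.jet.tot X.pt) := π.hasFDerivAt
  have hmem : (c.tot e) ∈ (c.tot.symm ≫ₕ c'.tot).source := by
    simp only [OpenPartialHomeomorph.trans_source, OpenPartialHomeomorph.symm_source,
      Set.mem_inter_iff, Set.mem_preimage, c.tot.left_inv he]
    exact ⟨c.tot.map_source he, he'⟩
  have hev : ∀ᶠ z in 𝓝 (c.jet.tot X.pt), π z ∈ (c.tot.symm ≫ₕ c'.tot).source :=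
    π.continuous.continuousAt.eventually_mem ((c.tot.symm ≫ₕ c'.tot).open_source.mem_nhds hmem)
  have hG : HasFDerivAt (fun z => g (π z)) ((fderiv ℝ g (c.tot e)).comp π) (c.jet.tot X.pt) :=
    HasFDerivAt.comp (c.jet.tot X.pt) (g := g) hg.hasFDerivAt hπ
  have hDG : HasFDerivAt (fun z => fderiv ℝ g (π z))
      ((fderiv ℝ (fderiv ℝ g) (c.tot e)).comp π) (c.jet.tot X.pt) :=
    HasFDerivAt.comp (c.jet.tot X.pt) (g := fderiv ℝ g) hdg.hasFDerivAt hπ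
  -- A component of DΨ may be computed from any explicit formula Q for that component valid over the
  -- overlap of the charts, by uniqueness of derivatives.
  have h1 : ∀ {W : Type _} [NormedAddCommGroup W] [NormedSpace ℝ W]
      (L : B × (F × (B →L[ℝ] F)) →L[ℝ] W) (Q : B × (F × (B →L[ℝ] F)) → W)
      (Q' : B × (F × (B →L[ℝ] F)) →L[ℝ] W), HasFDerivAt Q Q' (c.jet.tot X.pt) →
      (∀ z, π z ∈ (c.tot.symm ≫ₕ c'.tot).source → L (Ψ z) = Q z) →
      ∀ d, L (fderiv ℝ Ψ (c.jet.tot X.pt) d) = Q' d := by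
    intro W _ _ L Q Q' hQ hLQ d
    have h2 := L.hasFDerivAt.comp (c.jet.tot X.pt) hΨ.hasFDerivAt
    have h3 : Q =ᶠ[𝓝 (c.jet.tot X.pt)] L ∘ Ψ := by
      filter_upwards [hev] with z hz using (hLQ z hz).symm
    exact DFunLike.congr_fun ((h2.congr_of_eventuallyEq h3).unique hQ) d
  constructor
  · have h2 := h1 ((ContinuousLinearMap.fst ℝ F (B →L[ℝ] F)).comp (ContinuousLinearMap.snd ℝ B _))
      (fun z => (g (π z)).2) _ hG.snd (fun z hz => ?_) (w₀, c.jet.slope X w₀)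
    · rw [hs]
      exact h2
    · change (c'.tot (c.jet.tot.symm z).pt).2 = _
      rw [c.jet_tot_symm_pt hz.1]
      rfl
  · intro v
    have hK : HasFDerivAt (fun z => fderiv ℝ h (g (π z)).1 v)
        (((fderiv ℝ (fderiv ℝ h) x').comp ((ContinuousLinearMap.fst ℝ B F).comp
          ((fderiv ℝ g (c.tot e)).comp π))).flip v) (c.jet.tot X.pt) :=
      (ContinuousLinearMap.apply ℝ B v).hasFDerivAt.comp (c.jet.tot X.pt)
        (HasFDerivAt.comp (c.jet.tot X.pt) (g := fderiv ℝ h) (f := fun z => (g (π z)).1)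
          (hgx.symm ▸ hdh.hasFDerivAt) hG.fst)
    have hV : HasFDerivAt (fun z : B × (F × (B →L[ℝ] F)) => z.2.2)
        ((ContinuousLinearMap.snd ℝ F (B →L[ℝ] F)).comp (ContinuousLinearMap.snd ℝ B _))
        (c.jet.tot X.pt) :=
      ((ContinuousLinearMap.snd ℝ F (B →L[ℝ] F)).comp
        (ContinuousLinearMap.snd ℝ B _)).hasFDerivAt
    -- Product rule for the fiber component of Dg(π z)(k, V k), where k = Dh v depends on z through
    -- the new base point and V is the slope coordinate of z.
    have hQ := (hDG.clm_apply (hK.prodMk (hV.clm_apply hK))).snd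
    have h2 := h1 ((ContinuousLinearMap.apply ℝ F v).comp
      ((ContinuousLinearMap.snd ℝ F (B →L[ℝ] F)).comp (ContinuousLinearMap.snd ℝ B _)))
      _ _ hQ (fun z hz => ?_) (w₀, c.jet.slope X w₀)
    · rw [hs]
      refine h2.trans ?_
      have hπd : π (w₀, c.jet.slope X w₀) = (w₀, a) := rfl
      have hπX : π (c.jet.tot X.pt) = c.tot e := rfl
      have hX2 : (c.jet.tot X.pt).2.2 = u := rfl
      simp only [ContinuousLinearMap.comp_apply, add_apply,
        ContinuousLinearMap.prod_apply, ContinuousLinearMap.flip_apply,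
        ContinuousLinearMap.coe_fst', ContinuousLinearMap.coe_snd', hπd, hπX, hX2, hgx, hd1]
      rw [add_comm, add_comm (u _)]
    · change c'.slope (c.jet.tot.symm z) v = _
      have h3 := c.jet_tot_symm_pt hz.1
      have h4 : (c.jet.tot.symm z).pt ∈ c.tot.source := by
        rw [h3]
        exact c.tot.map_target hz.1
      have h5 : (c.jet.tot.symm z).pt ∈ c'.tot.source := by
        rw [h3]
        exact hz.2
      have h6 : (g (π z)).1 = c'.base (p (c.tot.symm (π z))) := c.fst_tot_change c' hz
      have h7 : c.tot (c.tot.symm (π z)) = π z := c.tot.right_inv hz.1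
      rw [c.slope_change_apply c' _ h4 h5, c.slope_jet_tot_symm hz.1, h6]
      change (c.jet.tot.symm z).pt = c.tot.symm (π z) at h3
      rw [h3, h7]

end FiberedChart
end CoordinateChange

/-! ### Chart independence and involutivity of `s_Γ`. -/

section Involution

variable {B F : Type*} [NormedAddCommGroup B] [NormedSpace ℝ B] [FiniteDimensional ℝ B]
  [NormedAddCommGroup F] [NormedSpace ℝ F]
  {M E : Type*} [TopologicalSpace M] [ChartedSpace B M]
  [TopologicalSpace E] [ChartedSpace (B × F) E]
  [IsManifold 𝓘(ℝ, B) ∞ M] [IsManifold 𝓘(ℝ, B × F) ∞ E] {p : E → M} [IsFiberedManifold B F p]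
  (cov : CovariantDerivative 𝓘(ℝ, B) B (TangentSpace 𝓘(ℝ, B) : M → Type _))
  (c c' : FiberedChart B F p) (X : JetJet B F p)

theorem modugnoInvolutionIn_coords (hX : X.pt.pt ∈ c.tot.source) :
    (modugnoInvolutionIn cov c X hX).pt.pt = X.pt.pt ∧
    (∀ v, c.slope (modugnoInvolutionIn cov c X hX).pt v = (c.jet.slope X v).1) ∧
    (∀ v, (c.jet.slope (modugnoInvolutionIn cov c X hX) v).1 = c.slope X.pt v) ∧
    ∀ w v, (c.jet.slope (modugnoInvolutionIn cov c X hX) w).2 v = (c.jet.slope X v).2 w +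
      (c.slope X.pt (connectionCoeff cov c.base_mem (c.mapsTo _ hX) w v) -
        (c.jet.slope X (connectionCoeff cov c.base_mem (c.mapsTo _ hX) w v)).1) := by
  refine ⟨rfl, fun v => ?_, fun v => ?_, fun w v => ?_⟩
  · simp only [modugnoInvolutionIn, FiberedChart.mkJet]
    exact DFunLike.congr_fun (c.slope_mkJet X.pt.pt hX _) v
  all_goals
    rw [modugnoInvolutionIn, FiberedChart.slope_mkJet]
    simp

/-- The involution over the domain of a fibered chart has the same expression in every other
fibered chart. -/
theorem modugnoInvolutionIn_change (hX : X.pt.pt ∈ c.tot.source) (hX' : X.pt.pt ∈ c'.tot.source) :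
    modugnoInvolutionIn cov c X hX = modugnoInvolutionIn cov c' X hX' := by
  set S := modugnoInvolutionIn cov c X hX with hS
  obtain ⟨hpt, hu, ha, hA⟩ := modugnoInvolutionIn_coords cov c X hX
  obtain ⟨hpt', hu', ha', hA'⟩ := modugnoInvolutionIn_coords cov c' X hX'
  rw [← hS] at hpt hu ha hA
  have hS1 : S.pt.pt ∈ c.tot.source := hpt.symm ▸ hX
  have hS2 : S.pt.pt ∈ c'.tot.source := hpt.symm ▸ hX'
  have key := fun w v => connectionCoeff_change cov c.base_mem c'.base_mem
    (c.mapsTo _ hX) (c'.mapsTo _ hX') w v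
  -- The final cancellation. Here D is Dg, Q the D²g term, d = D²h(w, v), γ = Γ(Dh w, Dh v) and A
  -- the transposed second-order coordinate; r, s are u and y₁ on γ, while q, t are u and y₁ on d.
  have hlin : ∀ (D : B × F →L[ℝ] B × F) (Q : B × F) (d γ : B) (A r s t q : F),
      (Q + D (d, A + (r - s) + t)).2 =
        (Q + D (d, A + q)).2 + ((D (γ - d, r - q)).2 - (D (γ - d, s - t)).2) := by
    intro D Q d γ A r s t q
    rw [← Prod.snd_sub, ← map_sub, ← Prod.snd_add, add_assoc Q, ← map_add]
    congr 3
    ext <;> simp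
    abel
  refine c'.jetJet_ext (X := modugnoInvolutionIn cov c' X hX') hX' hpt ?_ ?_
  · ext1 v
    rw [hu', c.slope_change_apply c' S.pt hS1 hS2, hu, (c.jet_slope_change_apply c' X hX hX' v).1]
    rfl
  · ext1 w
    refine Prod.ext ?_ ?_
    · rw [ha', (c.jet_slope_change_apply c' S hS1 hS2 w).1, ha,
        c.slope_change_apply c' X.pt hX hX']
      rfl
    · ext1 v
      rw [hA', (c.jet_slope_change_apply c' S hS1 hS2 w).2, ha, hA,
        c.slope_change_apply c' X.pt hX hX', (c.jet_slope_change_apply c' X hX hX' _).1,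
        (c.jet_slope_change_apply c' X hX hX' v).2]
      simp only [hpt, key, hu, map_sub, Prod.fst_sub]
      -- Transposition has exchanged the arguments of D²g and D²h on one side; their symmetry
      -- realigns them.
      rw [FiberedChart.fderiv_fderiv_change_symm c.tot_mem c'.tot_mem hX hX',
        FiberedChart.fderiv_fderiv_change_symm c'.base_mem c.base_mem (c'.mapsTo _ hX')
          (c.mapsTo _ hX) v w]
      exact hlin _ _ _ _ _ _ _ _ _

/-- Chart independence removes the arbitrary choice of chart from the definition of `s_Γ`, so every
later computation may use any convenient chart. -/
theorem modugnoInvolution_eq (hX : X.pt.pt ∈ c.tot.source) :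
    modugnoInvolution cov X = modugnoInvolutionIn cov c X hX :=
  modugnoInvolutionIn_change cov _ c X _ hX

theorem modugnoInvolution_involutive (hcov : cov.torsion = 0) :
    (modugnoInvolution cov : JetJet B F p → JetJet B F p).Involutive := by
  intro X
  obtain ⟨c, hX⟩ := exists_fiberedChart (B := B) (F := F) p X.pt.pt
  have h1 := modugnoInvolution_eq cov c X hX
  obtain ⟨hpt, hu, ha, hA⟩ := modugnoInvolutionIn_coords cov c X hX
  rw [← h1] at hpt hu ha hA
  have hS : (modugnoInvolution cov X).pt.pt ∈ c.tot.source := hpt.symm ▸ hX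
  have h2 := modugnoInvolution_eq cov c (modugnoInvolution cov X) hS
  obtain ⟨hpt', hu', ha', hA'⟩ := modugnoInvolutionIn_coords cov c (modugnoInvolution cov X) hS
  rw [← h2] at hpt' hu' ha' hA'
  refine c.jetJet_ext hX (hpt'.trans hpt) ?_ ?_
  · ext1 v
    rw [hu', ha]
  · ext1 w
    refine Prod.ext ?_ ?_
    · rw [ha', hu]
    · ext1 v
      rw [hA', hA, hu, ha]
      -- The two corrections are (u - y₁)(Γ(v, w)) and (y₁ - u)(Γ(w, v)); they cancel by symmetry of
      -- Γ.
      simp only [hpt, connectionCoeff_symm cov hcov c.base_mem _ w v]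
      abel

end Involution

/-- Near x the map f is the inverse chart of N' after T after the chart of N. Continuity of f need
not be known beforehand, since `hf` keeps its values in the domain of the target chart. -/
theorem contMDiffAt_of_chart_expression {V N V' N' : Type*} [NormedAddCommGroup V]
    [NormedSpace ℝ V] [TopologicalSpace N] [ChartedSpace V N] [IsManifold 𝓘(ℝ, V) ∞ N]
    [NormedAddCommGroup V'] [NormedSpace ℝ V'] [TopologicalSpace N'] [ChartedSpace V' N']
    [IsManifold 𝓘(ℝ, V') ∞ N'] {φ : OpenPartialHomeomorph N V} {φ' : OpenPartialHomeomorph N' V'}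
    (h : φ ∈ IsManifold.maximalAtlas 𝓘(ℝ, V) ∞ N) (h' : φ' ∈ IsManifold.maximalAtlas 𝓘(ℝ, V') ∞ N')
    {f : N → N'} {T : V → V'} {x : N} (hx : x ∈ φ.source) (hT : ContDiffAt ℝ ∞ T (φ x))
    (hf : ∀ y ∈ φ.source, f y ∈ φ'.source ∧ φ' (f y) = T (φ y)) :
    ContMDiffAt 𝓘(ℝ, V) 𝓘(ℝ, V') ∞ f x := by
  have h1 : ContMDiffAt 𝓘(ℝ, V) 𝓘(ℝ, V') ∞ (fun y => T (φ y)) x :=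
    hT.contMDiffAt.comp x (contMDiffAt_of_mem_maximalAtlas h hx)
  have h2 : ContMDiffAt 𝓘(ℝ, V') 𝓘(ℝ, V') ∞ φ'.symm (T (φ x)) := by
    rw [← (hf x hx).2]
    exact contMDiffAt_symm_of_mem_maximalAtlas h' (φ'.map_source (hf x hx).1)
  refine (h2.comp x h1).congr_of_eventuallyEq ?_
  filter_upwards [φ.open_source.mem_nhds hx] with y hy
  rw [Function.comp_apply, ← (hf y hy).2, φ'.left_inv (hf y hy).1]

/-! ### Smoothness of `s_Γ`. -/

section Smoothness

variable {B F : Type*} [NormedAddCommGroup B] [NormedSpace ℝ B] [FiniteDimensional ℝ B]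
  [NormedAddCommGroup F] [NormedSpace ℝ F]
  {M E : Type*} [TopologicalSpace M] [ChartedSpace B M]
  [TopologicalSpace E] [ChartedSpace (B × F) E]
  [IsManifold 𝓘(ℝ, B) ∞ M] [IsManifold 𝓘(ℝ, B × F) ∞ E]
  (cov : CovariantDerivative 𝓘(ℝ, B) B (TangentSpace 𝓘(ℝ, B) : M → Type _))

theorem exists_contDiffAt_connectionCoeff [T2Space M] [cov.ContMDiffCovariantDerivative ∞]
    {ψ : OpenPartialHomeomorph M B} (hψ : ψ ∈ IsManifold.maximalAtlas 𝓘(ℝ, B) ∞ M) :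
    ∃ G : B → B →L[ℝ] B →L[ℝ] B, (∀ z ∈ ψ.target, ContDiffAt ℝ ∞ G z) ∧
      ∀ (x : M) (hx : x ∈ ψ.source), connectionCoeff cov hψ hx = G (ψ x) := by
  classical
  -- The components exist only over the chart domain, hence the value 0 outside the open target. As
  -- B is finite-dimensional, smoothness of an operator-valued map can be tested on vectors.
  refine ⟨fun z => if hz : z ∈ ψ.target then connectionCoeff cov hψ (ψ.map_target hz) else 0,
    fun z hz => ?_, fun x hx => ?_⟩
  · refine ContDiffOn.contDiffAt ?_ (ψ.open_target.mem_nhds hz)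
    rw [contDiffOn_clm_apply]
    intro w
    rw [contDiffOn_clm_apply]
    intro v z hz
    have h1 := contMDiffAt_connectionCoeff_apply cov hψ (ψ.map_target hz) w v
    have h2 := contMDiffAt_symm_of_mem_maximalAtlas hψ hz
    refine ((h1.comp z h2).contDiffAt.contDiffWithinAt).congr_of_mem (fun y hy => ?_) hz
    simp only [dif_pos hy]
    rfl
  · have hz : ψ x ∈ ψ.target := ψ.map_source hx
    simp only [dif_pos hz, ψ.left_inv hx]

variable {p : E → M} [IsFiberedManifold B F p]

theorem contMDiff_modugnoInvolution [T2Space M] [cov.ContMDiffCovariantDerivative ∞] :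
    ContMDiff 𝓘(ℝ, B × ((F × (B →L[ℝ] F)) × (B →L[ℝ] F × (B →L[ℝ] F))))
      𝓘(ℝ, B × ((F × (B →L[ℝ] F)) × (B →L[ℝ] F × (B →L[ℝ] F)))) ∞
      (modugnoInvolution cov : JetJet B F p → JetJet B F p) := by
  intro X
  obtain ⟨c, hX⟩ := exists_fiberedChart (B := B) (F := F) p X.pt.pt
  obtain ⟨G, hG, hGΓ⟩ := exists_contDiffAt_connectionCoeff cov c.base_mem
  let y₁ : (B →L[ℝ] F × (B →L[ℝ] F)) → B →L[ℝ] F := fun a =>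
    (ContinuousLinearMap.fst ℝ F (B →L[ℝ] F)).comp a
  let y₂ : (B →L[ℝ] F × (B →L[ℝ] F)) → B →L[ℝ] B →L[ℝ] F := fun a =>
    (ContinuousLinearMap.snd ℝ F (B →L[ℝ] F)).comp a
  -- The expression of `s_Γ` in the chart of JJE. Pairs of operators are written through `inl` and
  -- `inr`, and transposition and composition as continuous linear maps, so that smoothness reduces
  -- to that of compositions of operators.
  let T : B × ((F × (B →L[ℝ] F)) × (B →L[ℝ] F × (B →L[ℝ] F))) →
      B × ((F × (B →L[ℝ] F)) × (B →L[ℝ] F × (B →L[ℝ] F))) := fun z =>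
    (z.1, ((z.2.1.1, y₁ z.2.2), (ContinuousLinearMap.inl ℝ F (B →L[ℝ] F)).comp z.2.1.2 +
      (ContinuousLinearMap.inr ℝ F (B →L[ℝ] F)).comp
        (ContinuousLinearMap.flipₗᵢ ℝ B B F (y₂ z.2.2) +
          (ContinuousLinearMap.compL ℝ B B F (z.2.1.2 - y₁ z.2.2)).comp (G z.1))))
  have hy₁ : ContDiff ℝ ∞ y₁ := contDiff_const.clm_comp contDiff_id
  have hy₂ : ContDiff ℝ ∞ y₂ := contDiff_const.clm_comp contDiff_id
  refine contMDiffAt_of_chart_expression (T := T) c.jet.jet.tot_mem c.jet.jet.tot_mem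
    (show X ∈ c.jet.jet.tot.source from hX) ?_ fun Y hY => ?_
  · have h0 : (c.jet.jet.tot X).1 ∈ c.base.target := by
      have : (c.jet.jet.tot X).1 = c.base (p X.pt.pt) := c.fst_eq _ hX
      rw [this]
      exact c.base.map_source (c.mapsTo _ hX)
    have hGz : ContDiffAt ℝ ∞
        (fun z : B × ((F × (B →L[ℝ] F)) × (B →L[ℝ] F × (B →L[ℝ] F))) => G z.1)
        (c.jet.jet.tot X) := (hG _ h0).comp _ contDiffAt_fst
    have hu : ContDiffAt ℝ ∞
        (fun z : B × ((F × (B →L[ℝ] F)) × (B →L[ℝ] F × (B →L[ℝ] F))) => z.2.1.2)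
        (c.jet.jet.tot X) := by fun_prop
    have hy₁' := hy₁.contDiffAt.comp (c.jet.jet.tot X)
      (f := fun z : B × ((F × (B →L[ℝ] F)) × (B →L[ℝ] F × (B →L[ℝ] F))) => z.2.2)
      (contDiffAt_snd.snd)
    have hy₂' := hy₂.contDiffAt.comp (c.jet.jet.tot X)
      (f := fun z : B × ((F × (B →L[ℝ] F)) × (B →L[ℝ] F × (B →L[ℝ] F))) => z.2.2)
      (contDiffAt_snd.snd)
    have hflip : ContDiff ℝ ∞ (fun a : B →L[ℝ] B →L[ℝ] F =>
        ContinuousLinearMap.flipₗᵢ ℝ B B F a) := LinearIsometryEquiv.contDiff _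
    have hcompL : ContDiff ℝ ∞ (fun a : B →L[ℝ] F => ContinuousLinearMap.compL ℝ B B F a) :=
      ContinuousLinearMap.contDiff _
    refine contDiffAt_fst.prodMk (((by fun_prop : ContDiffAt ℝ ∞
      (fun z : B × ((F × (B →L[ℝ] F)) × (B →L[ℝ] F × (B →L[ℝ] F))) => z.2.1.1) _).prodMk
      hy₁').prodMk ((contDiffAt_const.clm_comp hu).add (contDiffAt_const.clm_comp
        (ContDiffAt.add ?_ (ContDiffAt.clm_comp ?_ hGz)))))
    · exact hflip.contDiffAt.comp _ hy₂'
    · exact hcompL.contDiffAt.comp _ (hu.sub hy₁')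
  · have hY' : Y.pt.pt ∈ c.tot.source := hY
    obtain ⟨hpt, hu, ha, hA⟩ := modugnoInvolutionIn_coords cov c Y hY'
    rw [← modugnoInvolution_eq cov c Y hY'] at hpt hu ha hA
    have hz : c.jet.jet.tot Y = ((c.tot Y.pt.pt).1, (((c.tot Y.pt.pt).2, c.slope Y.pt),
      c.jet.slope Y)) := rfl
    refine ⟨(hpt.symm ▸ hY' : (modugnoInvolution cov Y).pt.pt ∈ c.tot.source), ?_⟩
    rw [hz]
    change ((c.tot (modugnoInvolution cov Y).pt.pt).1, (((c.tot (modugnoInvolution cov Y).pt.pt).2,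
      c.slope (modugnoInvolution cov Y).pt), c.jet.slope (modugnoInvolution cov Y))) = _
    refine Prod.ext (by rw [hpt]) (Prod.ext (Prod.ext (by rw [hpt]) (ContinuousLinearMap.ext hu))
      (ContinuousLinearMap.ext fun w => Prod.ext ?_ (ContinuousLinearMap.ext fun v => ?_)))
    · rw [ha]
      simp [T]
    · rw [hA, hGΓ]
      simp [T, y₁, y₂, c.fst_eq _ hY']

end Smoothness

/-! ### Jet prolongation of morphisms and of connections in coordinates. -/

section Prolongation

variable {B F : Type*} [NormedAddCommGroup B] [NormedSpace ℝ B]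
  [NormedAddCommGroup F] [NormedSpace ℝ F]
  {M E : Type*} [TopologicalSpace M] [ChartedSpace B M]
  [TopologicalSpace E] [ChartedSpace (B × F) E]
  [IsManifold 𝓘(ℝ, B) ∞ M] [IsManifold 𝓘(ℝ, B × F) ∞ E] {p : E → M} [IsFiberedManifold B F p]

/-- The coordinate expression of the jet prolongation of a morphism. -/
theorem FiberedChart.slope_map {F' E' : Type*} [NormedAddCommGroup F'] [NormedSpace ℝ F']
    [TopologicalSpace E'] [ChartedSpace (B × F') E'] [IsManifold 𝓘(ℝ, B × F') ∞ E'] {p' : E' → M}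
    [IsFiberedManifold B F' p'] (c : FiberedChart B F p) (c' : FiberedChart B F' p')
    (hb : c'.base = c.base) (f : E → E') (hf : MDifferentiable 𝓘(ℝ, B × F) 𝓘(ℝ, B × F') f)
    (h : ∀ e, p' (f e) = p e) (j : Jet B F p) (hj : j.pt ∈ c.tot.source)
    (hj' : f j.pt ∈ c'.tot.source) (v : B) :
    c'.slope (Jet.map f hf h j) v =
      (fderiv ℝ (c'.tot ∘ f ∘ c.tot.symm) (c.tot j.pt) (v, c.slope j v)).2 := by
  -- The transport along p' (f e) = p e in `Jet.map` is invisible on coordinate vectors;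
  -- generalizing the base point to a variable allows the equality to be eliminated.
  have key : ∀ (x : M) (hx : x = p j.pt),
      (hx ▸ j.lin : TangentSpace 𝓘(ℝ, B) x →L[ℝ] TangentSpace 𝓘(ℝ, B × F) j.pt)
        ((chartDeriv c.base x).inverse v) = j.lin ((chartDeriv c.base (p j.pt)).inverse v) := by
    rintro x rfl
    rfl
  have h1 := (mdiff_chart c.tot_mem).mdifferentiableAt hj
  have h2 := (mdiff_chart c.tot_mem).mdifferentiableAt_symm (c.tot.map_source hj)
  have h3 := (mdiff_chart c'.tot_mem).mdifferentiableAt hj'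
  have h4 : MDifferentiableAt 𝓘(ℝ, B × F) 𝓘(ℝ, B × F') (c'.tot ∘ f ∘ c.tot.symm)
      (c.tot j.pt) :=
    MDifferentiableAt.comp (c.tot j.pt)
      (by rw [Function.comp_apply, c.tot.left_inv hj]; exact h3)
      ((hf _).comp (c.tot j.pt) h2)
  have h5 := mfderiv_comp j.pt h4 h1
  have h6 := mfderiv_comp j.pt h3 (hf j.pt)
  have h7 : c'.tot ∘ f =ᶠ[𝓝 j.pt] (c'.tot ∘ f ∘ c.tot.symm) ∘ c.tot := by
    filter_upwards [c.tot.open_source.mem_nhds hj] with y hy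
    simp [c.tot.left_inv hy]
  have h8 := h7.mfderiv_eq (I := 𝓘(ℝ, B × F)) (I' := 𝓘(ℝ, B × F'))
  rw [h5, h6, mfderiv_eq_fderiv] at h8
  have h9 := DFunLike.congr_fun h8 (j.lin ((chartDeriv c.base (p j.pt)).inverse v))
  have h10 := c.dtot_lin j hj ((chartDeriv c.base (p j.pt)).inverse v)
  have h11 : c.dbase (p j.pt) ((chartDeriv c.base (p j.pt)).inverse v) = v :=
    chartDeriv_inverse_apply c.base_mem (c.mapsTo _ hj) v
  rw [h11] at h10
  have h12 : ∀ x, (c'.dbase x).inverse v = (chartDeriv c.base x).inverse v :=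
    fun x => congrArg (fun ψ => (chartDeriv ψ x).inverse v) hb
  rw [← h10]
  refine Eq.trans ?_ (congrArg Prod.snd h9)
  change (c'.dtot (f j.pt) (mfderiv 𝓘(ℝ, B × F) 𝓘(ℝ, B × F') f j.pt
    ((h j.pt ▸ j.lin : TangentSpace 𝓘(ℝ, B) (p' (f j.pt)) →L[ℝ] TangentSpace 𝓘(ℝ, B × F) j.pt)
      ((c'.dbase (p' (f j.pt))).inverse v)))).2 = _
  rw [h12, key _ (h j.pt)]
  rfl

/-- In charts the projection JE → E is the linear map (x, y, A) ↦ (x, y), which is its own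
derivative. -/
theorem FiberedChart.slope_mapPt (c : FiberedChart B F p) (X : JetJet B F p)
    (hX : X.pt.pt ∈ c.tot.source) (v : B) : c.slope X.mapPt v = (c.jet.slope X v).1 := by
  have h := c.jet.slope_map c rfl Jet.pt (Jet.contMDiff_pt.mdifferentiable (by simp))
    (fun _ => rfl) X hX hX v
  refine h.trans ?_
  let π : B × (F × (B →L[ℝ] F)) →L[ℝ] B × F :=
    (ContinuousLinearMap.fst ℝ B _).prod
      ((ContinuousLinearMap.fst ℝ F _).comp (ContinuousLinearMap.snd ℝ B _))
  have h1 : c.tot ∘ Jet.pt ∘ c.jet.tot.symm =ᶠ[𝓝 (c.jet.tot X.pt)] π := by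
    filter_upwards [c.jet.tot.open_target.mem_nhds (c.jet.tot.map_source hX)] with z hz
    simp only [Function.comp_apply]
    rw [c.jet_tot_symm_pt hz, c.tot.right_inv hz]
    rfl
  rw [h1.fderiv_eq, π.fderiv]
  rfl

variable (κ : Connection B F p) (c : FiberedChart B F p)

/-- The components of a connection in a fibered chart, as a function of the coordinates. -/
noncomputable def Connection.coeff (z : B × F) : B →L[ℝ] F := c.slope (κ (c.tot.symm z))

theorem Connection.contDiffAt_coeff {z : B × F} (hz : z ∈ c.tot.target) :
    ContDiffAt ℝ ∞ (κ.coeff c) z := by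
  have h1 : ContMDiffAt 𝓘(ℝ, B × F) 𝓘(ℝ, B × (F × (B →L[ℝ] F))) ∞
      (c.jet.tot ∘ κ ∘ c.tot.symm) z := by
    refine ContMDiffAt.comp z (contMDiffAt_of_mem_maximalAtlas c.jet.tot_mem ?_)
      (κ.contMDiff.contMDiffAt.comp z (contMDiffAt_symm_of_mem_maximalAtlas c.tot_mem hz))
    change (κ (c.tot.symm z)).pt ∈ c.tot.source
    rw [κ.pt_toFun]
    exact c.tot.map_target hz
  exact h1.contDiffAt.snd.snd

/-- In charts κ is the graph map z ↦ (z, K(z)); its derivative is evaluated on the lift (v, u v) of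
v. That the first component is again u expresses J p_E ∘ Jκ = id. -/
theorem Connection.jet_slope_prolong (u : Jet B F p) (hu : u.pt ∈ c.tot.source) (v : B) :
    c.jet.slope (κ.prolong u) v =
      (c.slope u v, fderiv ℝ (κ.coeff c) (c.tot u.pt) (v, c.slope u v)) := by
  have hκ : (κ u.pt).pt ∈ c.tot.source := by
    rw [κ.pt_toFun]
    exact hu
  have h := c.slope_map c.jet rfl κ (κ.contMDiff.mdifferentiable (by simp))
    (fun e => congrArg p (κ.pt_toFun e)) u hu hκ v
  refine h.trans ?_
  have hA := ((κ.contDiffAt_coeff c (c.tot.map_source hu)).differentiableAt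
    (by simp)).hasFDerivAt
  have h1 : c.jet.tot ∘ κ ∘ c.tot.symm =ᶠ[𝓝 (c.tot u.pt)]
      fun z => (z.1, (z.2, κ.coeff c z)) := by
    filter_upwards [c.tot.open_target.mem_nhds (c.tot.map_source hu)] with z hz
    simp only [Function.comp_apply, c.jet_tot_apply, κ.pt_toFun, c.tot.right_inv hz]
    rfl
  rw [h1.fderiv_eq, (hasFDerivAt_fst.prodMk (hasFDerivAt_snd.prodMk hA)).fderiv]
  rfl

theorem Connection.contMDiff_prolong :
    ContMDiff 𝓘(ℝ, B × (F × (B →L[ℝ] F)))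
      𝓘(ℝ, B × ((F × (B →L[ℝ] F)) × (B →L[ℝ] F × (B →L[ℝ] F)))) ∞
      (κ.prolong : Jet B F p → JetJet B F p) := by
  intro u
  obtain ⟨c, hu⟩ := exists_fiberedChart (B := B) (F := F) p u.pt
  let T : B × (F × (B →L[ℝ] F)) → B × ((F × (B →L[ℝ] F)) × (B →L[ℝ] F × (B →L[ℝ] F))) := fun z =>
    (z.1, ((z.2.1, κ.coeff c (z.1, z.2.1)),
      (ContinuousLinearMap.inl ℝ F (B →L[ℝ] F)).comp z.2.2 +
      (ContinuousLinearMap.inr ℝ F (B →L[ℝ] F)).comp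
        ((fderiv ℝ (κ.coeff c) (z.1, z.2.1)).comp (ContinuousLinearMap.inl ℝ B F +
          (ContinuousLinearMap.inr ℝ B F).comp z.2.2))))
  refine contMDiffAt_of_chart_expression (T := T) c.jet.tot_mem c.jet.jet.tot_mem
    (show u ∈ c.jet.tot.source from hu) ?_ fun w hw => ?_
  · have hA := κ.contDiffAt_coeff c (c.tot.map_source hu)
    have hπ : ContDiffAt ℝ ∞ (fun z : B × (F × (B →L[ℝ] F)) => (z.1, z.2.1)) (c.jet.tot u) := by
      fun_prop
    have hV : ContDiffAt ℝ ∞ (fun z : B × (F × (B →L[ℝ] F)) => z.2.2) (c.jet.tot u) := by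
      fun_prop
    have hA' : ContDiffAt ℝ ∞ (fun z : B × (F × (B →L[ℝ] F)) => κ.coeff c (z.1, z.2.1))
        (c.jet.tot u) := ContDiffAt.comp (c.jet.tot u) (g := κ.coeff c) hA hπ
    have hdA : ContDiffAt ℝ ∞
        (fun z : B × (F × (B →L[ℝ] F)) => fderiv ℝ (κ.coeff c) (z.1, z.2.1)) (c.jet.tot u) :=
      ContDiffAt.comp (c.jet.tot u) (g := fderiv ℝ (κ.coeff c)) (hA.fderiv_right (by simp)) hπ
    exact contDiffAt_fst.prodMk ((contDiffAt_snd.fst.prodMk hA').prodMk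
      ((contDiffAt_const.clm_comp hV).add (contDiffAt_const.clm_comp
        (hdA.clm_comp (contDiffAt_const.add (contDiffAt_const.clm_comp hV))))))
  · have hw' : w.pt ∈ c.tot.source := hw
    have hκ : (κ w.pt).pt = w.pt := κ.pt_toFun _
    refine ⟨(hκ.symm ▸ hw' : (κ w.pt).pt ∈ c.tot.source), ?_⟩
    change ((c.tot (κ w.pt).pt).1, (((c.tot (κ w.pt).pt).2, c.slope (κ w.pt)),
      c.jet.slope (κ.prolong w))) = T ((c.tot w.pt).1, ((c.tot w.pt).2, c.slope w))
    refine Prod.ext (by rw [hκ]) (Prod.ext (Prod.ext (by rw [hκ]) ?_)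
      (ContinuousLinearMap.ext fun v => ?_))
    · change c.slope (κ w.pt) = c.slope (κ (c.tot.symm (c.tot w.pt)))
      rw [c.tot.left_inv hw']
    · rw [κ.jet_slope_prolong c w hw']
      ext
      · simp [T]
      · simp only [T, add_apply, ContinuousLinearMap.comp_apply, ContinuousLinearMap.inl_apply,
          ContinuousLinearMap.inr_apply, Prod.mk_add_mk, add_zero, zero_add]

end Prolongation

/-! ### Expressions in bases of the model spaces. -/

section Coordinates

variable {B F : Type*} [NormedAddCommGroup B] [NormedSpace ℝ B] [FiniteDimensional ℝ B]
  [NormedAddCommGroup F] [NormedSpace ℝ F]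
  {M E : Type*} [TopologicalSpace M] [ChartedSpace B M]
  [TopologicalSpace E] [ChartedSpace (B × F) E]
  [IsManifold 𝓘(ℝ, B) ∞ M] [IsManifold 𝓘(ℝ, B × F) ∞ E] {p : E → M} [IsFiberedManifold B F p]
  {ι ν : Type*} [Fintype ι] [Fintype ν] (bB : Module.Basis ι ℝ B) (bF : Module.Basis ν ℝ F)
  (cov : CovariantDerivative 𝓘(ℝ, B) B (TangentSpace 𝓘(ℝ, B) : M → Type _))
  (c : FiberedChart B F p)

theorem FiberedChart.coordΓ_congr {e e' : E} (h : e = e') (he : e ∈ c.tot.source)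
    (he' : e' ∈ c.tot.source) (a d b : ι) : c.coordΓ bB cov he a d b = c.coordΓ bB cov he' a d b := by
  subst h
  rfl

/-- The expression of the involution of `J J E` in an arbitrary fibered chart. -/
theorem modugnoInvolution_coords (X : JetJet B F p) (hX : X.pt.pt ∈ c.tot.source) :
    (∀ i a, c.coordJ bB bF i a (modugnoInvolution cov X).pt = c.coordJJ₁ bB bF i a X) ∧
    (∀ i a, c.coordJJ₁ bB bF i a (modugnoInvolution cov X) = c.coordJ bB bF i a X.pt) ∧
    ∀ i a b, c.coordJJ₂ bB bF i a b (modugnoInvolution cov X) =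
      c.coordJJ₂ bB bF i b a X + ∑ d, c.coordΓ bB cov hX b d a *
        (c.coordJ bB bF i d X.pt - c.coordJJ₁ bB bF i d X) := by
  obtain ⟨-, hu, ha, hA⟩ := modugnoInvolutionIn_coords cov c X hX
  rw [← modugnoInvolution_eq cov c X hX] at hu ha hA
  refine ⟨fun i a => ?_, fun i a => ?_, fun i a b => ?_⟩
  · rw [FiberedChart.coordJ, hu, FiberedChart.coordJJ₁]
  · rw [FiberedChart.coordJJ₁, ha, FiberedChart.coordJ]
  · rw [FiberedChart.coordJJ₂, hA, map_add, Finsupp.add_apply, FiberedChart.coordJJ₂]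
    congr 1
    set γ := connectionCoeff cov c.base_mem (c.mapsTo _ hX) (bB b) (bB a)
    have hsum : γ = ∑ d, c.coordΓ bB cov hX b d a • bB d := (bB.sum_repr γ).symm
    -- The i-th component of u - y₁; expanding its argument Γ(∂_b, ∂_a) in the basis of B produces
    -- the sum over d.
    let L : B →ₗ[ℝ] ℝ := (bF.coord i).comp
      ((c.slope X.pt - (ContinuousLinearMap.fst ℝ F (B →L[ℝ] F)).comp
        (c.jet.slope X) : B →L[ℝ] F) : B →ₗ[ℝ] F)
    change L γ = _
    rw [hsum, map_sum]
    refine Finset.sum_congr rfl fun d _ => ?_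
    rw [map_smul, smul_eq_mul]
    congr 1
    exact congrFun (congrArg DFunLike.coe (map_sub bF.repr _ _)) i

/-- The horizontal lift of ∂_a by the jet u is ∂_a + y^j_a ∂_j, and the derivative is linear in its
direction. -/
theorem Connection.fderiv_coeff_coords [FiniteDimensional ℝ F] (κ : Connection B F p)
    (u : Jet B F p) (hu : u.pt ∈ c.tot.source) (i : ν) (a b : ι) :
    bF.repr (fderiv ℝ (κ.coeff c) (c.tot u.pt) (bB a, c.slope u (bB a)) (bB b)) i =
      c.partialX bB a (fun e => c.coordJ bB bF i b (κ e)) u.pt +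
      ∑ j, c.coordJ bB bF j a u * c.partialY bF j (fun e => c.coordJ bB bF i b (κ e)) u.pt := by
  have hA := ((κ.contDiffAt_coeff c (c.tot.map_source hu)).differentiableAt
    (by simp)).hasFDerivAt
  let L : (B →L[ℝ] F) →L[ℝ] ℝ := (LinearMap.toContinuousLinearMap (bF.coord i)).comp
    (ContinuousLinearMap.apply ℝ F (bB b))
  have hL : ∀ d, fderiv ℝ ((fun e => c.coordJ bB bF i b (κ e)) ∘ c.tot.symm) (c.tot u.pt) d =
      L (fderiv ℝ (κ.coeff c) (c.tot u.pt) d) :=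
    fun d => DFunLike.congr_fun (L.hasFDerivAt.comp (c.tot u.pt) hA).fderiv d
  simp only [FiberedChart.partialX, FiberedChart.partialY, hL]
  change L (fderiv ℝ (κ.coeff c) (c.tot u.pt) (bB a, c.slope u (bB a))) = _
  have hsum : (bB a, c.slope u (bB a)) =
      ((bB a, 0) + ∑ j, c.coordJ bB bF j a u • (0, bF j) : B × F) := by
    ext
    · simp [Prod.fst_sum]
    · simp only [Prod.snd_add, Prod.snd_sum, Prod.smul_snd, zero_add]
      exact (bF.sum_repr (c.slope u (bB a))).symm
  rw [hsum]
  simp only [map_add, map_sum, map_smul, smul_eq_mul]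

end Coordinates

/-! ### The connection s_Γ ∘ Jκ of JE → M. -/

section ProlongedConnection

variable {B F : Type*} [NormedAddCommGroup B] [NormedSpace ℝ B] [FiniteDimensional ℝ B]
  [NormedAddCommGroup F] [NormedSpace ℝ F]
  {M E : Type*} [TopologicalSpace M] [T2Space M] [ChartedSpace B M]
  [TopologicalSpace E] [ChartedSpace (B × F) E]
  [IsManifold 𝓘(ℝ, B) ∞ M] [IsManifold 𝓘(ℝ, B × F) ∞ E] {p : E → M} [IsFiberedManifold B F p]
  (cov : CovariantDerivative 𝓘(ℝ, B) B (TangentSpace 𝓘(ℝ, B) : M → Type _))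
  [cov.ContMDiffCovariantDerivative ∞] (κ : Connection B F p)

/-- The involution turns the base point into J p_E, and J p_E ∘ Jκ = J(p_E ∘ κ) is the identity. -/
theorem pt_modugnoInvolution_prolong (u : Jet B F p) :
    (modugnoInvolution cov (κ.prolong u)).pt = u := by
  obtain ⟨c, hu⟩ := exists_fiberedChart (B := B) (F := F) p u.pt
  have hpt : (κ.prolong u).pt.pt = u.pt := κ.pt_toFun _
  have hX : (κ.prolong u).pt.pt ∈ c.tot.source := hpt.symm ▸ hu
  obtain ⟨h1, h2, -⟩ := modugnoInvolutionIn_coords cov c (κ.prolong u) hX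
  rw [modugnoInvolution_eq cov c _ hX]
  refine c.jet_ext hu (h1.trans hpt) (ContinuousLinearMap.ext fun v => ?_)
  rw [h2, κ.jet_slope_prolong c u hu]

/-- The connection `s_Γ ∘ J κ` of `J E → M`. -/
noncomputable def Connection.jetProlongation :
    Connection B (F × (B →L[ℝ] F)) (Jet.proj : Jet B F p → M) where
  toFun u := modugnoInvolution cov (κ.prolong u)
  contMDiff := (contMDiff_modugnoInvolution cov).comp κ.contMDiff_prolong
  pt_toFun := pt_modugnoInvolution_prolong cov κ

/-- Dually, J p_E after the involution is the base point projection, and the base point of Jκ(u) is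
the value of κ at the point of u. -/
theorem mapPt_jetProlongation (u : Jet B F p) :
    Jet.mapPt (modugnoInvolution cov (κ.prolong u)) = κ u.pt := by
  obtain ⟨c, hu⟩ := exists_fiberedChart (B := B) (F := F) p u.pt
  have hpt : (κ.prolong u).pt.pt = u.pt := κ.pt_toFun _
  have hX : (κ.prolong u).pt.pt ∈ c.tot.source := hpt.symm ▸ hu
  obtain ⟨h1, -, h2, -⟩ := modugnoInvolutionIn_coords cov c (κ.prolong u) hX
  rw [← modugnoInvolution_eq cov c _ hX] at h1 h2
  refine c.jet_ext (hX : (κ u.pt).pt ∈ c.tot.source) h1 (ContinuousLinearMap.ext fun v => ?_)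
  rw [c.slope_mapPt _ (h1.symm ▸ hX), h2]
  rfl

end ProlongedConnection

end JetBundle

theorem mainTheorem1
    {B F : Type*} [NormedAddCommGroup B] [NormedSpace ℝ B] [FiniteDimensional ℝ B]
    [NormedAddCommGroup F] [NormedSpace ℝ F] [FiniteDimensional ℝ F]
    {M E : Type*} [TopologicalSpace M] [T2Space M] [ChartedSpace B M] [IsManifold 𝓘(ℝ, B) ∞ M]
    [TopologicalSpace E] [ChartedSpace (B × F) E] [IsManifold 𝓘(ℝ, B × F) ∞ E]
    (p : E → M) [IsFiberedManifold B F p]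
    {ι ν : Type*} [Fintype ι] [Fintype ν] (bB : Basis ι ℝ B) (bF : Basis ν ℝ F)
    (Γ : CovariantDerivative 𝓘(ℝ, B) B (TangentSpace 𝓘(ℝ, B) : M → Type _))
    [Γ.ContMDiffCovariantDerivative ∞] (hΓ : Γ.torsion = 0)
    (κ : Connection B F p) :
    -- `s_Γ` is a smooth involution of `J J E` with the stated expression in every fibered chart
    ((modugnoInvolution Γ : JetJet B F p → JetJet B F p).Involutive ∧
      ContMDiff 𝓘(ℝ, B × ((F × (B →L[ℝ] F)) × (B →L[ℝ] F × (B →L[ℝ] F))))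
        𝓘(ℝ, B × ((F × (B →L[ℝ] F)) × (B →L[ℝ] F × (B →L[ℝ] F)))) ∞
        (modugnoInvolution Γ : JetJet B F p → JetJet B F p) ∧
      ∀ X : JetJet B F p, (modugnoInvolution Γ X).pt.pt = X.pt.pt ∧
        ∀ (c : FiberedChart B F p) (hX : X.pt.pt ∈ c.tot.source),
          (∀ i a, c.coordJ bB bF i a (modugnoInvolution Γ X).pt = c.coordJJ₁ bB bF i a X) ∧
          (∀ i a, c.coordJJ₁ bB bF i a (modugnoInvolution Γ X) = c.coordJ bB bF i a X.pt) ∧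
          ∀ i a b, c.coordJJ₂ bB bF i a b (modugnoInvolution Γ X) =
            c.coordJJ₂ bB bF i b a X + ∑ d, c.coordΓ bB Γ hX b d a *
              (c.coordJ bB bF i d X.pt - c.coordJJ₁ bB bF i d X)) ∧
    -- `κ' = s_Γ ∘ J κ` is a connection of `J E → M`
    ∃ κ' : Connection B (F × (B →L[ℝ] F)) (Jet.proj : Jet B F p → M),
      (∀ u : Jet B F p, κ' u = modugnoInvolution Γ (κ.prolong u)) ∧
      -- it is projectable over `κ`
      (∀ u : Jet B F p, Jet.mapPt (κ' u) = κ u.pt) ∧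
      -- its coordinate expression
      ∀ (c : FiberedChart B F p) (u : Jet B F p) (hu : u.pt ∈ c.tot.source),
        (∀ a, c.coordX bB a (κ' u).proj = c.coordX bB a u.proj) ∧
        (∀ i, c.coordY bF i (κ' u).pt.pt = c.coordY bF i u.pt) ∧
        (∀ i a, c.coordJ bB bF i a (κ' u).pt = c.coordJ bB bF i a u) ∧
        (∀ i a, c.coordJJ₁ bB bF i a (κ' u) = c.coordJ bB bF i a (κ u.pt)) ∧
        ∀ i a b, c.coordJJ₂ bB bF i a b (κ' u) =
          c.partialX bB a (fun e => c.coordJ bB bF i b (κ e)) u.pt +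
          ∑ j, c.coordJ bB bF j a u * c.partialY bF j (fun e => c.coordJ bB bF i b (κ e)) u.pt +
          ∑ d, c.coordΓ bB Γ hu b d a *
            (c.coordJ bB bF i d (κ u.pt) - c.coordJ bB bF i d u) := by
  refine ⟨⟨modugnoInvolution_involutive Γ hΓ, contMDiff_modugnoInvolution Γ, fun X => ⟨?_,
    fun c hX => modugnoInvolution_coords bB bF Γ c X hX⟩⟩, κ.jetProlongation Γ, fun _ => rfl,
    mapPt_jetProlongation Γ κ, fun c u hu => ?_⟩
  · obtain ⟨c, hX⟩ := exists_fiberedChart (B := B) (F := F) p X.pt.pt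
    rw [modugnoInvolution_eq Γ c X hX]
    exact (modugnoInvolutionIn_coords Γ c X hX).1
  · have hu' : (κ.jetProlongation Γ u).pt = u := pt_modugnoInvolution_prolong Γ κ u
    have hpt : (κ.prolong u).pt.pt = u.pt := κ.pt_toFun _
    have hX : (κ.prolong u).pt.pt ∈ c.tot.source := hpt.symm ▸ hu
    obtain ⟨-, h₁, h₂⟩ := modugnoInvolution_coords bB bF Γ c (κ.prolong u) hX
    refine ⟨fun a => ?_, fun i => by rw [hu'], fun i a => by rw [hu'], h₁, fun i a b => ?_⟩
    · rw [Jet.proj, hu']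
    · refine (h₂ i a b).trans ?_
      -- The transposed coordinate y_ba of Jκ(u) is the derivative of κ_b along the lift of ∂_a. In
      -- the Γ term, κ is the base point slope of Jκ(u) and u its first-order slope, which gives κ_d
      -- - y_d.
      rw [← κ.fderiv_coeff_coords bB bF c u hu, FiberedChart.coordJJ₂,
        κ.jet_slope_prolong c u hu]
      refine congrArg₂ (· + ·) rfl (Finset.sum_congr rfl fun d _ => ?_)
      rw [c.coordΓ_congr bB Γ hpt hX hu, FiberedChart.coordJJ₁, κ.jet_slope_prolong c u hu]
      rfl
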